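/- For $c\in[0,1]$, $v\in\mathbb R^3$ and $d_1,d_2,d_3>0$ let $D_c(v;d_1,d_2,d_3)$ be the set of all $x\in\mathbb R^3$ such that $y=x-v$ satisfies $$|y_1+2cy_2+3c^2y_3|\le d_1,\qquad |y_2+3cy_3|\le d_2,\qquad |y_3|\le d_3 .$$ Up to absolute constants, when $d_1\le d_2\le d_3$, this is the rectangular box with dimensions $(d_1,d_2,d_3)$ along the Frenet frame $(\mathbf t,\mathbf n,\mathbf b)$ of the twisted cubic $(t,t^2,t^3)$ at $t=c$. Fix an integer $K\ge1$. A set $B$ is called a $(d_1,d_2,d_3)$-box with orientation $c$ if $D_c(v;d_1/K,d_2/K,d_3/K)\subset B\subset D_c(v;Kd_1,Kd_2,Kd_3)$ for some $v$. A collection of sets has bounded overlap if no point lies in more than $K$ of them. Let $R\ge2$, and divide $[0,1]$ into the intervals $I=[c_I,c_I+R^{-1/3}]$ with $c_I=jR^{-1/3}$, $0\le j<R^{1/3}$ (the last one may stick out of $[0,1]$). A Vinogradov tube associated with $I$ is an $(R^{2/3},R^{2/3},R)$-box with orientation $c_I$; so its long edge points in the binormal direction $\mathbf b(I)$. Let $\mathbb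 T=\bigsqcup_I\mathbb T(I)$ be a finite collection of tubes contained in $[-R,R]^3$, where $\mathbb T(I)$ consists of Vinogradov tubes associated with $I$, and suppose that $\mathbb T$ is separated: each $\mathbb T(I)$ has bounded overlap. Let $1\le N_1\le N$ be integers such that, for each $I$: (S1) $[-R,R]^3$ has a cover with bounded overlap by $(R^{2/3},R,R)$-boxes (plates) $S_I$ with orientation $c_I$ such that each $T\in\mathbb T(I)$ sits inside some $S_I$ of the cover, and each such $S_I$ contains at most $N$ tubes $T\in\mathbb T(I)$. (S2) $[-R,R]^3$ has a cover with bounded overlap by $(R^{2/3},R^{5/6},R)$-boxes $B_I$ with orientation $c_I$ such that each $T\in\mathbb T(I)$ sits inside some $B_I$ of the cover, and each such $B_I$ contains at most $N_1$ tubes $T\in\mathbb T(I)$. Let $1\le r\le R^{1/3}$, and let $\mathcal Q_r$ be a finite collection of closed cubes (of any orientation) with side lengths in $[K^{-1}R^{2/3},KR^{2/3}]$ and pairwise disjoint interiors, each of which is $r$-rich, that is, intersects at least $r$ tubes $T\in\mathbb T$. Then there are a dyadic number $\sigma=2^{-k}$, $k\in\{0,1,2,\dots\}$, with $R^{-1/3}\le\sigma\le1$,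 and a non-negative integer $M_\sigma$ such that $$|\mathcal Q_r|\lessapprox\begin{cases}\dfrac{|\mathbb T|M_\sigma\,\sigma R^{1/3}}{r^2}&\text{if }\sigma\ge R^{-1/6},\\[2mm]\dfrac{|\mathbb T|M_\sigma\,\sigma^3R^{2/3}}{r^2}&\text{if }\sigma<R^{-1/6},\end{cases}\qquad r\lessapprox\begin{cases}R^{1/3}M_\sigma\sigma^2&\text{if }\sigma\ge R^{-1/6},\\ R^{2/3}M_\sigma\sigma^4&\text{if }\sigma<R^{-1/6},\end{cases}$$ and $$M_\sigma\lesssim\begin{cases}\sigma^{-1}\min(N_1,\sigma^{-1})&\text{if }\sigma\ge R^{-1/6},\\ \sigma^{-3}R^{-1/3}\min(N_1\sigma^{-1}R^{-1/6},N)&\text{if }\sigma<R^{-1/6}.\end{cases}$$ Here $X\lesssim Y$ means $X\le CY$ and $X\lessapprox Y$ means $X\le C(\log R)^AY$, where $A$ is an absolute constant and $C$ depends only on $K$. -/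

import Mathlib

/-- Euclidean three-space. -/
abbrev E3 : Type := EuclideanSpace ℝ (Fin 3)

/-- The cube `[-R, R]^3`. -/
def bigCube (R : ℝ) : Set E3 := {x | ∀ i, |x i| ≤ R}

/-- The number of intervals in the partition of `[0, 1]` into intervals of length `R^(-1/3)`
(if `R^(1/3)` is not an integer, the last interval sticks out of `[0, 1]`). -/
noncomputable def numIntervals (R : ℝ) : ℕ := ⌈R ^ ((1 : ℝ) / 3)⌉₊

/-- The left endpoint `c` of the `j`-th interval `I = [c, c + R^(-1/3)]`. -/
noncomputable def leftEndpoint (R : ℝ) (j : Fin (numIntervals R)) : ℝ :=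
  (j : ℕ) * R ^ (-((1 : ℝ) / 3))

/-- The box centred at `v` with half-dimensions `(d₁, d₂, d₃)` with respect to the tangent, normal
and binormal directions of the twisted cubic `(t, t², t³)` at `t = c`:
`|y₁ + 2cy₂ + 3c²y₃| ≤ d₁`, `|y₂ + 3cy₃| ≤ d₂`, `|y₃| ≤ d₃`, where `y = x - v`.
The edge on which the first two forms vanish has the binormal direction `(3c², -3c, 1)`, and
the faces on which the first form is constant have the tangent `(1, 2c, 3c²)` as a normal. -/
def frenetBox (c : ℝ) (v : E3) (d₁ d₂ d₃ : ℝ) : Set E3 :=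
  {x | |(x 0 - v 0) + 2 * c * (x 1 - v 1) + 3 * c ^ 2 * (x 2 - v 2)| ≤ d₁ ∧
       |(x 1 - v 1) + 3 * c * (x 2 - v 2)| ≤ d₂ ∧
       |x 2 - v 2| ≤ d₃}

/-- `B` is a `(d₁, d₂, d₃)`-box with the orientation of the Frenet frame at `c`, up to the
factor `K`: it lies between the `K⁻¹`-dilate and the `K`-dilate of one and the same model box. -/
def IsFrenetBox (K : ℕ) (c d₁ d₂ d₃ : ℝ) (B : Set E3) : Prop :=
  ∃ v : E3, frenetBox c v (d₁ / K) (d₂ / K) (d₃ / K) ⊆ B ∧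
    B ⊆ frenetBox c v (K * d₁) (K * d₂) (K * d₃)

/-- Every point lies in at most `K` members of the collection. -/
def BoundedOverlap (K : ℕ) (F : Set (Set E3)) : Prop :=
  ∀ x : E3, {B | B ∈ F ∧ x ∈ B}.encard ≤ K

/-- `T j` is the collection of the Vinogradov tubes at scale `R` that are associated with the
`j`-th interval. All tubes lie in `[-R, R]^3`, and the collection is separated: the tubes
associated with one and the same interval have bounded overlap. -/
def IsSeparatedTubeFamily (K : ℕ) (R : ℝ) (T : Fin (numIntervals R) → Finset (Set E3)) : Prop :=
  ∀ j, (∀ t ∈ T j,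
      IsFrenetBox K (leftEndpoint R j) (R ^ ((2 : ℝ) / 3)) (R ^ ((2 : ℝ) / 3)) R t ∧
        t ⊆ bigCube R) ∧
    BoundedOverlap K (T j : Set (Set E3))

/-- For each interval `I`, a boundedly overlapping cover of `[-R, R]^3` by `(d₁, d₂, d₃)`-boxes
with the orientation of `I` has the property that each tube associated with `I` sits inside one
of these boxes, and each of these boxes contains at most `n` tubes associated with `I`. -/
def AtMostPerBox (K : ℕ) (R d₁ d₂ d₃ : ℝ) (T : Fin (numIntervals R) → Finset (Set E3))
    (n : ℕ) : Prop :=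
  ∀ j, ∃ F : Set (Set E3),
    (∀ B ∈ F, IsFrenetBox K (leftEndpoint R j) d₁ d₂ d₃ B) ∧
    bigCube R ⊆ ⋃₀ F ∧
    BoundedOverlap K F ∧
    (∀ t ∈ T j, ∃ B ∈ F, t ⊆ B) ∧
    ∀ B ∈ F, {t | t ∈ T j ∧ t ⊆ B}.ncard ≤ n

/-- `q` is a closed cube, of any orientation, with side length `s`. -/
def IsCubeOfSide (s : ℝ) (q : Set E3) : Prop :=
  ∃ φ : E3 ≃ᵢ E3, q = φ '' {y | ∀ i, |y i| ≤ s / 2}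

/-- The number of tubes of the family that intersect `q`. -/
noncomputable def richness {n : ℕ} (T : Fin n → Finset (Set E3)) (q : Set E3) : ℕ :=
  ∑ j, {t | t ∈ T j ∧ (t ∩ q).Nonempty}.ncard

/-- `Q` is a collection of `r`-rich cubes with side lengths comparable to `R^(2/3)` which are
pairwise disjoint, up to their boundaries. -/
def IsRichCubeFamily (K : ℕ) (R r : ℝ) {n : ℕ} (T : Fin n → Finset (Set E3))
    (Q : Finset (Set E3)) : Prop :=
  (∀ q ∈ Q, (∃ s : ℝ, R ^ ((2 : ℝ) / 3) / K ≤ s ∧ s ≤ K * R ^ ((2 : ℝ) / 3) ∧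
      IsCubeOfSide s q) ∧ r ≤ (richness T q : ℝ)) ∧
  ∀ q ∈ Q, ∀ q' ∈ Q, q ≠ q' → Disjoint (interior q) (interior q')

namespace FrenetBox

open MeasureTheory

/-- The coordinates of `x` with respect to which `frenetBox c` is a rectangular box. -/
def coord (c : ℝ) (x : Fin 3 → ℝ) : Fin 3 → ℝ :=
  ![x 0 + 2 * c * x 1 + 3 * c ^ 2 * x 2, x 1 + 3 * c * x 2, x 2]

/-- The coordinates of a frequency that are dual to `coord c`. -/
def dualCoord (c : ℝ) (ξ : Fin 3 → ℝ) : Fin 3 → ℝ :=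
  ![ξ 0, ξ 1 - 2 * c * ξ 0, ξ 2 - 3 * c * ξ 1 + 3 * c ^ 2 * ξ 0]

/-- The Gaussian adapted to the box with dimensions `d`. -/
noncomputable def gauss (d z : Fin 3 → ℝ) : ℝ := Real.exp (-(1 / 2) * ∑ k, (z k / d k) ^ 2)

/-- The Gaussian adapted to the dual of the box with dimensions `d`. -/
noncomputable def dualGauss (d ζ : Fin 3 → ℝ) : ℝ := Real.exp (-(1 / 2) * ∑ k, (d k * ζ k) ^ 2)

lemma coord_sub (c : ℝ) (x y : Fin 3 → ℝ) : coord c (x - y) = coord c x - coord c y := by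
  ext k; fin_cases k <;> simp [coord] <;> ring

lemma sum_mul_eq_sum_coord (c : ℝ) (x ξ : Fin 3 → ℝ) :
    ∑ k, x k * ξ k = ∑ k, coord c x k * dualCoord c ξ k := by
  simp [Fin.sum_univ_three, coord, dualCoord]; ring

lemma gauss_nonneg (d z : Fin 3 → ℝ) : 0 ≤ gauss d z := (Real.exp_pos _).le

lemma dualGauss_nonneg (d z : Fin 3 → ℝ) : 0 ≤ dualGauss d z := (Real.exp_pos _).le

lemma continuous_dualCoord (c : ℝ) : Continuous (dualCoord c) := by
  refine continuous_pi fun k => ?_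
  fin_cases k <;> simp only [dualCoord] <;> simp <;> fun_prop

lemma measurePreserving_dualCoord (c : ℝ) :
    MeasurePreserving (dualCoord c) volume volume := by
  have hM : (!![1, 0, 0; -2 * c, 1, 0; 3 * c ^ 2, -3 * c, 1] : Matrix (Fin 3) (Fin 3) ℝ).det
      = 1 := by
    simp [Matrix.det_fin_three]
  have h := Real.map_matrix_volume_pi_eq_smul_volume_pi (M := _) (hM.trans_ne one_ne_zero)
  have hf : (Matrix.toLin' (!![1, 0, 0; -2 * c, 1, 0; 3 * c ^ 2, -3 * c, 1] :
      Matrix (Fin 3) (Fin 3) ℝ) : (Fin 3 → ℝ) → (Fin 3 → ℝ)) = dualCoord c := by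
    funext ξ
    ext k
    fin_cases k <;> simp [dualCoord, Matrix.mulVec, dotProduct, Fin.sum_univ_three] <;> ring
  rw [hM, hf] at h
  exact ⟨(continuous_dualCoord c).measurable, by simpa using h⟩

lemma cexp_eq (d x ζ : Fin 3 → ℝ) :
    Complex.exp (Complex.I * (∑ k, x k * ζ k : ℝ)) * (dualGauss d ζ : ℂ) =
      Complex.exp (-∑ k, (((d k) ^ 2 / 2 : ℝ) : ℂ) * (ζ k : ℂ) ^ 2 +
        ∑ k, (Complex.I * x k) * ζ k) := by
  rw [dualGauss, Complex.ofReal_exp, ← Complex.exp_add]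
  congr 1
  push_cast
  simp only [Fin.sum_univ_three]
  ring

lemma re_sq_pos {d : Fin 3 → ℝ} (hd : ∀ k, 0 < d k) (k : Fin 3) :
    0 < ((((d k) ^ 2 / 2 : ℝ) : ℂ)).re := by
  rw [Complex.ofReal_re]; have := hd k; positivity

lemma integrable_cexp_mul_dualGauss {d : Fin 3 → ℝ} (hd : ∀ k, 0 < d k) (x : Fin 3 → ℝ) :
    Integrable fun ζ : Fin 3 → ℝ =>
      Complex.exp (Complex.I * (∑ k, x k * ζ k : ℝ)) * (dualGauss d ζ : ℂ) := by
  simp_rw [cexp_eq]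
  exact GaussianFourier.integrable_cexp_neg_sum_mul_add (re_sq_pos hd) _

lemma integral_cexp_mul_dualGauss {d : Fin 3 → ℝ} (hd : ∀ k, 0 < d k) (x : Fin 3 → ℝ) :
    ∫ ζ : Fin 3 → ℝ,
      Complex.exp (Complex.I * (∑ k, x k * ζ k : ℝ)) * (dualGauss d ζ : ℂ) =
      ((∏ k, (Real.sqrt (2 * Real.pi) / d k)) * gauss d x : ℝ) := by
  simp_rw [cexp_eq]
  rw [GaussianFourier.integral_cexp_neg_sum_mul_add (re_sq_pos hd), Finset.prod_mul_distrib,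
    Complex.ofReal_mul, Complex.ofReal_prod]
  congr 1
  · refine Finset.prod_congr rfl fun k _ => ?_
    have h := hd k
    rw [← Complex.ofReal_div, show (1 / 2 : ℂ) = ((1 / 2 : ℝ) : ℂ) by norm_num,
      ← Complex.ofReal_cpow (by positivity), ← Real.sqrt_eq_rpow]
    congr 1
    rw [show Real.pi / (d k ^ 2 / 2) = (2 * Real.pi) / d k ^ 2 by field_simp,
      Real.sqrt_div (by positivity), Real.sqrt_sq h.le]
  · rw [gauss, Complex.ofReal_exp, ← Complex.exp_sum]
    congr 1
    push_cast
    rw [Finset.mul_sum]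
    refine Finset.sum_congr rfl fun k _ => ?_
    have h : (d k : ℂ) ≠ 0 := by exact_mod_cast (hd k).ne'
    rw [mul_pow, Complex.I_sq]
    field_simp
    ring

/-- The phase of the plane wave of frequency `ξ` at `x`. -/
def phase (x ξ : Fin 3 → ℝ) : ℝ := ∑ k, x k * ξ k

lemma cexp_re_eq (d x ζ : Fin 3 → ℝ) :
    (Complex.exp (Complex.I * (∑ k, x k * ζ k : ℝ)) * (dualGauss d ζ : ℂ)).re =
      Real.cos (phase x ζ) * dualGauss d ζ := by
  rw [Complex.re_mul_ofReal, mul_comm Complex.I, Complex.exp_ofReal_mul_I_re, phase]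

lemma integrable_cos_mul_dualGauss {d : Fin 3 → ℝ} (hd : ∀ k, 0 < d k) (c : ℝ)
    (x : Fin 3 → ℝ) :
    Integrable fun ξ => Real.cos (phase x ξ) * dualGauss d (dualCoord c ξ) := by
  have h := (integrable_cexp_mul_dualGauss hd (coord c x)).re
  have h2 := (measurePreserving_dualCoord c).integrable_comp_of_integrable h
  refine h2.congr (Filter.Eventually.of_forall fun ξ => ?_)
  simp only [Function.comp_apply, RCLike.re_to_complex]
  rw [cexp_re_eq, phase, phase, ← sum_mul_eq_sum_coord]

lemma integral_cos_mul_dualGauss {d : Fin 3 → ℝ} (hd : ∀ k, 0 < d k) (c : ℝ)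
    (x : Fin 3 → ℝ) :
    ∫ ξ, Real.cos (phase x ξ) * dualGauss d (dualCoord c ξ) =
      (∏ k, (Real.sqrt (2 * Real.pi) / d k)) * gauss d (coord c x) := by
  have hi := integrable_cexp_mul_dualGauss hd (coord c x)
  have h := integral_re hi
  rw [integral_cexp_mul_dualGauss hd] at h
  simp only [RCLike.re_to_complex, Complex.ofReal_re, cexp_re_eq] at h
  rw [← h]
  have hae := hi.re.aestronglyMeasurable
  simp only [RCLike.re_to_complex, cexp_re_eq] at hae
  rw [← (measurePreserving_dualCoord c).map_eq] at hae
  conv_rhs => rw [← (measurePreserving_dualCoord c).map_eq]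
  rw [integral_map (measurePreserving_dualCoord c).measurable.aemeasurable hae]
  simp_rw [phase, ← sum_mul_eq_sum_coord]

/-- The exponential sum of a finite family of points. -/
noncomputable def expSum {α : Type*} (s : Finset α) (p : α → Fin 3 → ℝ) (ξ : Fin 3 → ℝ) : ℂ :=
  ∑ t ∈ s, Complex.exp ((phase (p t) ξ : ℝ) * Complex.I)

lemma phase_sub (x y ξ : Fin 3 → ℝ) : phase (x - y) ξ = phase x ξ - phase y ξ := by
  simp [phase, Fin.sum_univ_three]; ring

lemma re_expSum_mul_conj {α β : Type*} (s : Finset α) (p : α → Fin 3 → ℝ)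
    (Q : Finset β) (y : β → Fin 3 → ℝ) (ξ : Fin 3 → ℝ) :
    (expSum s p ξ * (starRingEnd ℂ) (expSum Q y ξ)).re =
      ∑ t ∈ s, ∑ q ∈ Q, Real.cos (phase (p t - y q) ξ) := by
  rw [expSum, expSum, map_sum, Finset.sum_mul_sum, Complex.re_sum]
  refine Finset.sum_congr rfl fun t _ => ?_
  rw [Complex.re_sum]
  refine Finset.sum_congr rfl fun q _ => ?_
  rw [← Complex.exp_conj, map_mul, Complex.conj_I, Complex.conj_ofReal, ← Complex.exp_add,
    phase_sub, ← Complex.exp_ofReal_mul_I_re]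
  congr 2
  push_cast
  ring

lemma norm_expSum_sq {α : Type*} (s : Finset α) (p : α → Fin 3 → ℝ) (ξ : Fin 3 → ℝ) :
    ‖expSum s p ξ‖ ^ 2 = ∑ t ∈ s, ∑ t' ∈ s, Real.cos (phase (p t - p t') ξ) := by
  rw [← re_expSum_mul_conj, Complex.mul_conj, Complex.normSq_eq_norm_sq, Complex.ofReal_re]

lemma integrable_sum_cos {α β : Type*} (s : Finset α) (p : α → Fin 3 → ℝ)
    (Q : Finset β) (y : β → Fin 3 → ℝ) {d : Fin 3 → ℝ} (hd : ∀ k, 0 < d k) (c : ℝ) :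
    Integrable fun ξ =>
      (∑ t ∈ s, ∑ q ∈ Q, Real.cos (phase (p t - y q) ξ)) * dualGauss d (dualCoord c ξ) := by
  simp_rw [Finset.sum_mul]
  exact integrable_finsetSum _ fun t _ => integrable_finsetSum _ fun q _ =>
    integrable_cos_mul_dualGauss hd c _

lemma integral_sum_cos {α β : Type*} (s : Finset α) (p : α → Fin 3 → ℝ)
    (Q : Finset β) (y : β → Fin 3 → ℝ) {d : Fin 3 → ℝ} (hd : ∀ k, 0 < d k) (c : ℝ) :
    ∫ ξ, (∑ t ∈ s, ∑ q ∈ Q, Real.cos (phase (p t - y q) ξ)) * dualGauss d (dualCoord c ξ) =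
      (∏ k, (Real.sqrt (2 * Real.pi) / d k)) *
        ∑ t ∈ s, ∑ q ∈ Q, gauss d (coord c (p t - y q)) := by
  simp_rw [Finset.sum_mul]
  rw [integral_finsetSum _ fun t _ => integrable_finsetSum _ fun q _ =>
    integrable_cos_mul_dualGauss hd c _, Finset.mul_sum]
  refine Finset.sum_congr rfl fun t _ => ?_
  rw [integral_finsetSum _ fun q _ => integrable_cos_mul_dualGauss hd c _, Finset.mul_sum]
  exact Finset.sum_congr rfl fun q _ => integral_cos_mul_dualGauss hd c _

lemma abs_div_one_add_sq_le (x h : ℝ) :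
    |h| / (1 + x ^ 2) ≤ 2 * (1 + h ^ 2) * |Real.arctan (x + h) - Real.arctan x| := by
  have key : ∀ x h : ℝ, 0 ≤ h →
      h / (1 + x ^ 2) ≤ 2 * (1 + h ^ 2) * (Real.arctan (x + h) - Real.arctan x) ∧
      h / (1 + (x + h) ^ 2) ≤ 2 * (1 + h ^ 2) * (Real.arctan (x + h) - Real.arctan x) := by
    intro x h hh
    rcases hh.eq_or_lt with rfl | hpos
    · simp
    obtain ⟨τ, ⟨h1, h2⟩, h3⟩ := exists_deriv_eq_slope Real.arctan (a := x) (b := x + h)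
      (by linarith) Real.continuous_arctan.continuousOn
      (Real.differentiable_arctan.differentiableOn)
    simp only [Real.deriv_arctan] at h3
    have h4 : Real.arctan (x + h) - Real.arctan x = h * (1 / (1 + τ ^ 2)) := by
      rw [h3, add_sub_cancel_left]; field_simp
    have aux : ∀ w : ℝ, (τ - w) ^ 2 ≤ h ^ 2 →
        h / (1 + w ^ 2) ≤ 2 * (1 + h ^ 2) * (h * (1 / (1 + τ ^ 2))) := by
      intro w hw
      have : 1 + τ ^ 2 ≤ 2 * (1 + h ^ 2) * (1 + w ^ 2) := by
        nlinarith [sq_nonneg (τ - 2 * w), mul_nonneg (sq_nonneg h) (sq_nonneg w)]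
      rw [show 2 * (1 + h ^ 2) * (h * (1 / (1 + τ ^ 2))) = (2 * (1 + h ^ 2) * h) / (1 + τ ^ 2) by
        ring, div_le_div_iff₀ (by positivity) (by positivity)]
      nlinarith [mul_le_mul_of_nonneg_left this hh]
    rw [h4]
    exact ⟨aux x (by nlinarith), aux (x + h) (by nlinarith)⟩
  rcases le_total 0 h with hh | hh
  · rw [abs_of_nonneg hh]
    refine (key x h hh).1.trans ?_
    gcongr
    exact le_abs_self _
  · rw [abs_of_nonpos hh]
    have := (key (x + h) (-h) (by linarith)).2
    rw [show x + h + -h = x by ring, neg_sq] at this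
    refine this.trans ?_
    gcongr
    rw [abs_sub_comm]
    exact le_abs_self _

lemma one_div_one_add_sq_add_le (x h : ℝ) :
    1 / (1 + (x + h) ^ 2) ≤ 2 * (1 + h ^ 2) * (1 / (1 + x ^ 2)) := by
  rw [show 2 * (1 + h ^ 2) * (1 / (1 + x ^ 2)) = (2 * (1 + h ^ 2)) / (1 + x ^ 2) by ring,
    div_le_div_iff₀ (by positivity) (by positivity)]
  nlinarith [sq_nonneg (x + 2 * h), sq_nonneg (h * (x + h))]

/-- A bounded sequence that first decreases and then increases has bounded variation. -/
lemma sum_abs_sub_le_of_monotone_sign {g d : ℕ → ℝ} {B : ℝ} (hB : ∀ j, |g j| ≤ B)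
    (hd : Monotone d) (hneg : ∀ j, d j < 0 → g (j + 1) ≤ g j)
    (hpos : ∀ j, 0 ≤ d j → g j ≤ g (j + 1)) (m : ℕ) :
    ∑ j ∈ Finset.range m, |g (j + 1) - g j| ≤ 4 * B := by
  suffices h : ∑ j ∈ Finset.range m, |g (j + 1) - g j| ≤ g m + 3 * B by
    linarith [(abs_le.1 (hB m)).2]
  induction m with
  | zero => simp; linarith [(abs_le.1 (hB 0)).1, (abs_nonneg _).trans (hB 0)]
  | succ m ih =>
    rcases lt_or_ge (d m) 0 with hm | hm
    · have : ∑ j ∈ Finset.range (m + 1), |g (j + 1) - g j| =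
          ∑ j ∈ Finset.range (m + 1), (g j - g (j + 1)) := by
        refine Finset.sum_congr rfl fun j hj => ?_
        have hj' : d j < 0 := (hd (by simp at hj; omega)).trans_lt hm
        rw [abs_of_nonpos (by linarith [hneg j hj'])]; ring
      rw [this, Finset.sum_range_sub']
      linarith [(abs_le.1 (hB 0)).2, (abs_le.1 (hB (m + 1))).1]
    · rw [Finset.sum_range_succ, abs_of_nonneg (by linarith [hpos m hm])]
      linarith

lemma sum_abs_arctan_sub_le {u : ℕ → ℝ} {α γ : ℝ} (hu : ∀ j, u (j + 1) - u j = α + γ * j)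
    (m : ℕ) :
    ∑ j ∈ Finset.range m, |Real.arctan (u (j + 1)) - Real.arctan (u j)| ≤ 2 * Real.pi := by
  have hB : ∀ x, |Real.arctan x| ≤ Real.pi / 2 := fun x =>
    abs_le.2 ⟨(Real.neg_pi_div_two_lt_arctan x).le, (Real.arctan_lt_pi_div_two x).le⟩
  have h4 : 2 * Real.pi = 4 * (Real.pi / 2) := by ring
  rw [h4]
  rcases le_total 0 γ with hγ | hγ
  · refine sum_abs_sub_le_of_monotone_sign (g := fun j => Real.arctan (u j))
      (d := fun j => α + γ * j) (fun j => hB _) ?_ ?_ ?_ m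
    · intro i j hij
      have : (i : ℝ) ≤ j := by exact_mod_cast hij
      simp only; gcongr
    · intro j hj
      exact Real.arctan_strictMono.monotone (by linarith [hu j])
    · intro j hj
      exact Real.arctan_strictMono.monotone (by linarith [hu j])
  · have := sum_abs_sub_le_of_monotone_sign (g := fun j => -Real.arctan (u j))
      (d := fun j => -(α + γ * j)) (B := Real.pi / 2) (fun j => by rw [abs_neg]; exact hB _)
      ?_ ?_ ?_ m
    · refine le_of_eq_of_le (Finset.sum_congr rfl fun j _ => ?_) this
      rw [← abs_neg]; congr 1; ring
    · intro i j hij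
      have : (i : ℝ) ≤ j := by exact_mod_cast hij
      simp only
      nlinarith
    · intro j hj
      exact neg_le_neg (Real.arctan_strictMono.monotone (by linarith [hu j]))
    · intro j hj
      exact neg_le_neg (Real.arctan_strictMono.monotone (by linarith [hu j]))

lemma exp_neg_le_one_div {x : ℝ} : Real.exp (-(1 / 4) * x ^ 2) ≤ 4 * (1 / (1 + x ^ 2)) := by
  rw [show -(1 / 4) * x ^ 2 = -(x ^ 2 / 4) by ring, Real.exp_neg,
    show 4 * (1 / (1 + x ^ 2)) = ((1 + x ^ 2) / 4)⁻¹ by rw [inv_div]; ring]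
  refine inv_anti₀ (by positivity) ?_
  linarith [Real.add_one_le_exp (x ^ 2 / 4)]

lemma overlap_term_le {a b u h L : ℝ} (hL : 1 ≤ L) (hh : h = -3 * b + 3 * a / L) :
    Real.exp (-(1 / 4) * (a ^ 2 + b ^ 2 + u ^ 2)) * (|b| + 1 / L) ≤
      195 * |Real.arctan (u + h) - Real.arctan u| + 2 / L := by
  have hL0 : 0 < L := by linarith
  set E := Real.exp (-(1 / 4) * (a ^ 2 + b ^ 2 + u ^ 2)) with hE
  have hE0 : 0 < E := Real.exp_pos _
  have hE1 : E ≤ 1 := Real.exp_le_one_iff.2 (by nlinarith [sq_nonneg a, sq_nonneg b, sq_nonneg u])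
  have hEa : E * |a| ≤ 1 := by
    have h1 : E ≤ Real.exp (-(a ^ 2 / 4)) :=
      Real.exp_le_exp.2 (by nlinarith [sq_nonneg b, sq_nonneg u])
    have h2 : |a| ≤ Real.exp (a ^ 2 / 4) := by
      refine le_trans ?_ (Real.add_one_le_exp _)
      nlinarith [sq_nonneg (|a| - 2), sq_abs a]
    calc E * |a| ≤ Real.exp (-(a ^ 2 / 4)) * Real.exp (a ^ 2 / 4) := by gcongr
      _ = 1 := by rw [← Real.exp_add]; simp
  have hb : |b| ≤ |h| / 3 + |a| / L := by
    have h1 : b = -h / 3 + a / L := by rw [hh]; ring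
    calc |b| = |-h / 3 + a / L| := by rw [← h1]
      _ ≤ |-h / 3| + |a / L| := abs_add_le _ _
      _ = |h| / 3 + |a| / L := by
        rw [abs_div, abs_div, abs_neg, abs_of_pos hL0, abs_of_pos (by norm_num : (0 : ℝ) < 3)]
  have hmain : E * |h| ≤ 584 * |Real.arctan (u + h) - Real.arctan u| := by
    have hsplit : E = Real.exp (-((a ^ 2 + b ^ 2) / 4)) * Real.exp (-(1 / 4) * u ^ 2) := by
      rw [hE, ← Real.exp_add]; congr 1; ring
    have h1 := abs_div_one_add_sq_le u h
    have h2 : Real.exp (-((a ^ 2 + b ^ 2) / 4)) * (1 + h ^ 2) ≤ 73 := by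
      have h3 : 1 + h ^ 2 ≤ 73 * Real.exp ((a ^ 2 + b ^ 2) / 4) := by
        have h4 := Real.add_one_le_exp ((a ^ 2 + b ^ 2) / 4)
        have h5 : h ^ 2 ≤ 18 * b ^ 2 + 18 * a ^ 2 := by
          have h6 : (a / L) ^ 2 ≤ a ^ 2 := by
            rw [div_pow]
            exact div_le_self (sq_nonneg _) (by nlinarith)
          have h7 : h = -3 * b + 3 * (a / L) := by rw [hh]; ring
          rw [h7]
          nlinarith [sq_nonneg (b + a / L)]
        nlinarith [sq_nonneg a, sq_nonneg b]
      calc Real.exp (-((a ^ 2 + b ^ 2) / 4)) * (1 + h ^ 2)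
          ≤ Real.exp (-((a ^ 2 + b ^ 2) / 4)) * (73 * Real.exp ((a ^ 2 + b ^ 2) / 4)) := by gcongr
        _ = 73 := by rw [mul_left_comm, ← Real.exp_add]; simp
    calc E * |h| ≤ Real.exp (-((a ^ 2 + b ^ 2) / 4)) * (4 * (1 / (1 + u ^ 2))) * |h| := by
          rw [hsplit]; gcongr; exact exp_neg_le_one_div
      _ = 4 * Real.exp (-((a ^ 2 + b ^ 2) / 4)) * (|h| / (1 + u ^ 2)) := by ring
      _ ≤ 4 * Real.exp (-((a ^ 2 + b ^ 2) / 4)) *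
          (2 * (1 + h ^ 2) * |Real.arctan (u + h) - Real.arctan u|) := by gcongr
      _ = 8 * (Real.exp (-((a ^ 2 + b ^ 2) / 4)) * (1 + h ^ 2)) *
          |Real.arctan (u + h) - Real.arctan u| := by ring
      _ ≤ 8 * 73 * |Real.arctan (u + h) - Real.arctan u| := by gcongr
      _ = _ := by ring
  calc E * (|b| + 1 / L) ≤ E * (|h| / 3 + |a| / L + 1 / L) := by gcongr
    _ = (E * |h|) / 3 + (E * |a|) / L + E / L := by ring
    _ ≤ (584 * |Real.arctan (u + h) - Real.arctan u|) / 3 + 1 / L + 1 / L := by gcongr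
    _ ≤ 195 * |Real.arctan (u + h) - Real.arctan u| + 2 / L := by
      have := abs_nonneg (Real.arctan (u + h) - Real.arctan u)
      ring_nf; ring_nf at this; linarith

lemma sum_sq_le_dualCoord {c : ℝ} (h0 : 0 ≤ c) (h1 : c ≤ 1) (ξ : Fin 3 → ℝ) :
    ξ 0 ^ 2 + ξ 1 ^ 2 + ξ 2 ^ 2 ≤
      36 * (ξ 0 ^ 2 + (dualCoord c ξ 1) ^ 2 + (dualCoord c ξ 2) ^ 2) := by
  have hb : dualCoord c ξ 1 = ξ 1 - 2 * c * ξ 0 := rfl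
  have hβ : dualCoord c ξ 2 = ξ 2 - 3 * c * ξ 1 + 3 * c ^ 2 * ξ 0 := rfl
  set a := ξ 0
  set b := dualCoord c ξ 1
  set β := dualCoord c ξ 2
  have e1 : ξ 1 = b + 2 * (c * a) := by rw [hb]; ring
  have e2 : ξ 2 = β + 3 * (c * b) + 3 * (c ^ 2 * a) := by rw [hβ, hb]; ring
  have hc2 : c ^ 2 ≤ 1 := pow_le_one₀ h0 h1
  have i1 : (c * a) ^ 2 ≤ a ^ 2 := by
    rw [mul_pow]; exact mul_le_of_le_one_left (sq_nonneg _) hc2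
  have i2 : (c * b) ^ 2 ≤ b ^ 2 := by
    rw [mul_pow]; exact mul_le_of_le_one_left (sq_nonneg _) hc2
  have i3 : (c ^ 2 * a) ^ 2 ≤ a ^ 2 := by
    rw [mul_pow]; exact mul_le_of_le_one_left (sq_nonneg _) (pow_le_one₀ (by positivity) hc2)
  rw [e1, e2]
  nlinarith [sq_nonneg (b - 2 * (c * a)), sq_nonneg (β - 3 * (c * b)),
    sq_nonneg (β - 3 * (c ^ 2 * a)), sq_nonneg (c * b - c ^ 2 * a), sq_nonneg β]

/-- The dual planks of the Vinogradov tubes, weighted by the distance to the tangent direction,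
have bounded overlap. -/
lemma sum_dualGauss_mul_le {L : ℝ} (hL : 1 ≤ L) {m : ℕ} (hm : ∀ j < m, (j : ℝ) / L ≤ 1)
    (hm2 : (m : ℝ) ≤ 2 * L) (ξ : Fin 3 → ℝ) :
    ∑ j : Fin m, dualGauss ![1, 1, L] (dualCoord ((j : ℕ) / L) ξ) *
      (|dualCoord ((j : ℕ) / L) ξ 1| + 1 / L) ≤
      1300 * dualGauss (fun _ => 1 / 9) (dualCoord 0 ξ) := by
  have hL0 : 0 < L := by linarith
  rw [Fin.sum_univ_eq_sum_range (fun j => dualGauss ![1, 1, L] (dualCoord ((j : ℕ) / L) ξ) *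
      (|dualCoord ((j : ℕ) / L) ξ 1| + 1 / L)) m]
  set u : ℕ → ℝ := fun j => L * dualCoord (j / L) ξ 2 with hu
  have hdiff : ∀ j, u (j + 1) - u j = (-3 * ξ 1 + 3 * ξ 0 / L) + (6 * ξ 0 / L) * j := by
    intro j
    simp only [hu, dualCoord]
    simp
    field_simp
    ring
  have hterm : ∀ j ∈ Finset.range m, dualGauss ![1, 1, L] (dualCoord ((j : ℕ) / L) ξ) *
      (|dualCoord ((j : ℕ) / L) ξ 1| + 1 / L) ≤
      dualGauss (fun _ => 1 / 9) (dualCoord 0 ξ) *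
        (195 * |Real.arctan (u (j + 1)) - Real.arctan (u j)| + 2 / L) := by
    intro j hj
    have hj1 := hm j (Finset.mem_range.1 hj)
    have hc0 : (0 : ℝ) ≤ j / L := by positivity
    have h1 := overlap_term_le (a := ξ 0) (b := dualCoord (j / L) ξ 1) (u := u j)
      (h := u (j + 1) - u j) hL (by
        rw [hdiff]; simp [dualCoord]; field_simp; ring)
    rw [show u j + (u (j + 1) - u j) = u (j + 1) by ring] at h1
    have h2 : dualGauss ![1, 1, L] (dualCoord ((j : ℕ) / L) ξ) ≤
        dualGauss (fun _ => 1 / 9) (dualCoord 0 ξ) *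
        Real.exp (-(1 / 4) * (ξ 0 ^ 2 + dualCoord (j / L) ξ 1 ^ 2 + u j ^ 2)) := by
      rw [dualGauss, dualGauss, ← Real.exp_add]
      refine Real.exp_le_exp.2 ?_
      have h3 := sum_sq_le_dualCoord hc0 hj1 ξ
      have h4 : (dualCoord (j / L) ξ 2) ^ 2 ≤ (u j) ^ 2 := by
        rw [hu]; simp only [mul_pow]
        exact le_mul_of_one_le_left (sq_nonneg _) (by nlinarith)
      have e0 : dualCoord (j / L) ξ 0 = ξ 0 := rfl
      have e00 : dualCoord 0 ξ 0 = ξ 0 := rfl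
      have e01 : dualCoord 0 ξ 1 = ξ 1 := by simp [dualCoord]
      have e02 : dualCoord 0 ξ 2 = ξ 2 := by simp [dualCoord]
      simp only [Fin.sum_univ_three, e0, e00, e01, e02]
      simp only [Matrix.cons_val_zero, Matrix.cons_val_one, Matrix.cons_val]
      have e3 : L * dualCoord (j / L) ξ 2 = u j := rfl
      rw [e3]
      nlinarith [sq_nonneg (ξ 0), sq_nonneg (ξ 1), sq_nonneg (ξ 2)]
    calc _ ≤ (dualGauss (fun _ => 1 / 9) (dualCoord 0 ξ) *
        Real.exp (-(1 / 4) * (ξ 0 ^ 2 + dualCoord (j / L) ξ 1 ^ 2 + u j ^ 2))) *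
          (|dualCoord ((j : ℕ) / L) ξ 1| + 1 / L) := by gcongr
      _ = dualGauss (fun _ => 1 / 9) (dualCoord 0 ξ) *
        (Real.exp (-(1 / 4) * (ξ 0 ^ 2 + dualCoord (j / L) ξ 1 ^ 2 + u j ^ 2)) *
          (|dualCoord ((j : ℕ) / L) ξ 1| + 1 / L)) := by ring
      _ ≤ _ := mul_le_mul_of_nonneg_left h1 (dualGauss_nonneg _ _)
  refine (Finset.sum_le_sum hterm).trans ?_
  rw [← Finset.mul_sum, Finset.sum_add_distrib, ← Finset.mul_sum, mul_comm]
  refine mul_le_mul_of_nonneg_right ?_ (dualGauss_nonneg _ _)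
  have h5 := sum_abs_arctan_sub_le hdiff m
  have h6 : ∑ j ∈ Finset.range m, 2 / L ≤ 4 := by
    rw [Finset.sum_const, Finset.card_range, nsmul_eq_mul, mul_div_assoc', div_le_iff₀ hL0]
    linarith
  linarith [Real.pi_lt_d2]

/-- The high-frequency weight is dominated by Gaussians at all scales up to `Λ`. -/
lemma high_weight_le {L Λ b : ℝ} (hΛ : 1 ≤ Λ) (hΛL : Λ ≤ L) :
    (1 - Real.exp (-(1 / 2) * (Λ * b) ^ 2)) ^ 2 / (|b| + 1 / L) ≤
      8 * ∑ l ∈ Finset.Icc 1 ⌈Λ⌉₊, Real.exp (-(1 / 2) * (((l : ℝ) ^ 2 - 1) * b ^ 2)) := by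
  have hΛ0 : 0 < Λ := by linarith
  have hL0 : 0 < L := by linarith
  have hw : 0 < |b| + 1 / L := by positivity
  set μ := 1 / (|b| + 1 / Λ) with hμ
  have hpos : 0 < |b| + 1 / Λ := by positivity
  have hμ0 : 0 < μ := by positivity
  have hμΛ : μ ≤ Λ := by
    rw [hμ, div_le_iff₀ hpos, mul_add, mul_one_div_cancel hΛ0.ne']
    nlinarith [abs_nonneg b]
  have hμb : μ * |b| ≤ 1 := by
    rw [hμ, one_div_mul_eq_div, div_le_one hpos]
    linarith [show 0 < 1 / Λ by positivity]
  have step1 : (1 - Real.exp (-(1 / 2) * (Λ * b) ^ 2)) ^ 2 / (|b| + 1 / L) ≤ 2 * μ := by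
    set X := Real.exp (-(1 / 2) * (Λ * b) ^ 2) with hX
    have hX0 : 0 < X := Real.exp_pos _
    have hX1 : X ≤ 1 := Real.exp_le_one_iff.2 (by nlinarith [sq_nonneg (Λ * b)])
    have hX2 : 1 - X ≤ (Λ * b) ^ 2 / 2 := by
      have := Real.add_one_le_exp (-(1 / 2) * (Λ * b) ^ 2)
      linarith
    rw [hμ, mul_one_div, div_le_div_iff₀ hw hpos]
    have hsq : (1 - X) ^ 2 ≤ 1 := pow_le_one₀ (by linarith) (by linarith)
    have hLinv : 0 < 1 / L := by positivity
    rcases le_total 1 (Λ * |b|) with h | h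
    · have : 1 / Λ ≤ |b| := by rw [div_le_iff₀ hΛ0]; linarith
      calc (1 - X) ^ 2 * (|b| + 1 / Λ) ≤ 1 * (|b| + |b|) := by gcongr
        _ ≤ 2 * (|b| + 1 / L) := by linarith
    · have h3 : (Λ * b) ^ 2 = (Λ * |b|) ^ 2 := by rw [mul_pow, mul_pow, sq_abs]
      have h4 : 0 ≤ Λ * |b| := by positivity
      have h5 : (1 - X) ^ 2 ≤ (Λ * |b|) ^ 2 := by
        refine pow_le_pow_left₀ (by linarith) ?_ 2
        rw [h3] at hX2
        nlinarith
      calc (1 - X) ^ 2 * (|b| + 1 / Λ) ≤ (Λ * |b|) ^ 2 * (|b| + 1 / Λ) := by gcongr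
        _ = (Λ * |b|) * |b| * (Λ * |b| + 1) := by field_simp
        _ ≤ 1 * |b| * (1 + 1) := by gcongr
        _ ≤ 2 * (|b| + 1 / L) := by linarith
  have hceil : 1 ≤ ⌈Λ⌉₊ := Nat.one_le_ceil_iff.2 hΛ0
  have step2 : μ ≤ 4 * ∑ l ∈ Finset.Icc 1 ⌈Λ⌉₊,
      Real.exp (-(1 / 2) * (((l : ℝ) ^ 2 - 1) * b ^ 2)) := by
    rcases lt_or_ge μ 1 with h | h
    · have h1 : Real.exp (-(1 / 2) * ((((1 : ℕ) : ℝ) ^ 2 - 1) * b ^ 2)) ≤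
          ∑ l ∈ Finset.Icc 1 ⌈Λ⌉₊, Real.exp (-(1 / 2) * (((l : ℝ) ^ 2 - 1) * b ^ 2)) :=
        Finset.single_le_sum
          (f := fun l : ℕ => Real.exp (-(1 / 2) * (((l : ℝ) ^ 2 - 1) * b ^ 2)))
          (fun _ _ => (Real.exp_pos _).le) (by simp; exact hΛ0)
      norm_num at h1 ⊢
      linarith
    · have hk : ⌊μ⌋₊ ≤ ⌈Λ⌉₊ := (Nat.floor_le_ceil _).trans (Nat.ceil_mono hμΛ)
      have h1 : ∑ l ∈ Finset.Icc 1 ⌊μ⌋₊, (1 / 2 : ℝ) ≤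
          ∑ l ∈ Finset.Icc 1 ⌈Λ⌉₊, Real.exp (-(1 / 2) * (((l : ℝ) ^ 2 - 1) * b ^ 2)) := by
        refine (Finset.sum_le_sum fun l hl => ?_).trans
          (Finset.sum_le_sum_of_subset_of_nonneg (Finset.Icc_subset_Icc_right hk)
            fun _ _ _ => (Real.exp_pos _).le)
        have hl' : (l : ℝ) ≤ μ := (Nat.le_floor_iff hμ0.le).1 (Finset.mem_Icc.1 hl).2
        have h2 : ((l : ℝ) * |b|) ^ 2 ≤ 1 := by
          refine pow_le_one₀ (by positivity) (le_trans ?_ hμb)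
          gcongr
        rw [mul_pow, sq_abs] at h2
        have h3 := Real.add_one_le_exp (-(1 / 2) * (((l : ℝ) ^ 2 - 1) * b ^ 2))
        nlinarith [sq_nonneg b]
      rw [Finset.sum_const, Nat.card_Icc, nsmul_eq_mul] at h1
      have h2 : μ < ⌊μ⌋₊ + 1 := Nat.lt_floor_add_one μ
      have h3 : (1 : ℝ) ≤ ⌊μ⌋₊ := by exact_mod_cast (Nat.one_le_floor_iff μ).2 h
      push_cast [Nat.add_sub_cancel] at h1
      linarith
  linarith

lemma dualGauss_eq_mul_exp (s L : ℝ) (ζ : Fin 3 → ℝ) :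
    dualGauss ![1, s, L] ζ =
      dualGauss ![1, 1, L] ζ * Real.exp (-(1 / 2) * ((s ^ 2 - 1) * ζ 1 ^ 2)) := by
  rw [dualGauss, dualGauss, ← Real.exp_add]
  congr 1
  simp [Fin.sum_univ_three]
  ring

lemma re_mul_conj_mul_le {A B : ℂ} {e X w τ : ℝ} (he : 0 ≤ e) (hX : 0 ≤ 1 - X) (hw : 0 < w)
    (hτ : 0 < τ) :
    (A * (starRingEnd ℂ) B).re * (e - e * X) ≤
      τ * (1 / 2 * (‖A‖ ^ 2 * (e * ((1 - X) ^ 2 / w)))) + τ⁻¹ * (1 / 2 * (‖B‖ ^ 2 * (e * w))) := by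
  have h1 : (A * (starRingEnd ℂ) B).re ≤ ‖A‖ * ‖B‖ := by
    refine (Complex.re_le_norm _).trans ?_
    rw [norm_mul, RCLike.norm_conj]
  have h2 : (A * (starRingEnd ℂ) B).re * (e - e * X) ≤ (‖A‖ * ‖B‖) * (e * (1 - X)) := by
    rw [show e - e * X = e * (1 - X) by ring]
    gcongr
  have h3 : 0 ≤ e / (2 * τ * w) * (τ * ‖A‖ * (1 - X) - ‖B‖ * w) ^ 2 := by positivity
  have h4 : τ * (1 / 2 * (‖A‖ ^ 2 * (e * ((1 - X) ^ 2 / w)))) +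
      τ⁻¹ * (1 / 2 * (‖B‖ ^ 2 * (e * w))) - (‖A‖ * ‖B‖) * (e * (1 - X)) =
      e / (2 * τ * w) * (τ * ‖A‖ * (1 - X) - ‖B‖ * w) ^ 2 := by
    field_simp
    ring
  linarith

/-- Cauchy–Schwarz on the high-frequency part, pointwise in frequency space. -/
lemma sum_re_mul_dualGauss_le {L Λ : ℝ} (hΛ : 1 ≤ Λ) (hΛL : Λ ≤ L) {m : ℕ}
    (hm : ∀ j < m, (j : ℝ) / L ≤ 1) (hm2 : (m : ℝ) ≤ 2 * L) {τ : ℝ} (hτ : 0 < τ)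
    (A : Fin m → ℂ) (B : ℂ) (ξ : Fin 3 → ℝ) :
    ∑ j : Fin m, (A j * (starRingEnd ℂ) B).re *
      (dualGauss ![1, 1, L] (dualCoord ((j : ℕ) / L) ξ) -
        dualGauss ![1, Real.sqrt (1 + Λ ^ 2), L] (dualCoord ((j : ℕ) / L) ξ)) ≤
      4 * τ * (∑ j : Fin m, ∑ l ∈ Finset.Icc 1 ⌈Λ⌉₊,
        ‖A j‖ ^ 2 * dualGauss ![1, (l : ℝ), L] (dualCoord ((j : ℕ) / L) ξ)) +
      650 * τ⁻¹ * (‖B‖ ^ 2 * dualGauss (fun _ => 1 / 9) (dualCoord 0 ξ)) := by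
  have hL : 1 ≤ L := hΛ.trans hΛL
  have hterm : ∀ j : Fin m, (A j * (starRingEnd ℂ) B).re *
      (dualGauss ![1, 1, L] (dualCoord ((j : ℕ) / L) ξ) -
        dualGauss ![1, Real.sqrt (1 + Λ ^ 2), L] (dualCoord ((j : ℕ) / L) ξ)) ≤
      4 * τ * (∑ l ∈ Finset.Icc 1 ⌈Λ⌉₊,
        ‖A j‖ ^ 2 * dualGauss ![1, (l : ℝ), L] (dualCoord ((j : ℕ) / L) ξ)) +
      τ⁻¹ * (1 / 2 * (‖B‖ ^ 2 * (dualGauss ![1, 1, L] (dualCoord ((j : ℕ) / L) ξ) *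
        (|dualCoord ((j : ℕ) / L) ξ 1| + 1 / L)))) := by
    intro j
    set ζ := dualCoord ((j : ℕ) / L) ξ with hζ
    have he := dualGauss_nonneg ![1, 1, L] ζ
    have hX : 0 ≤ 1 - Real.exp (-(1 / 2) * (Λ * ζ 1) ^ 2) := by
      have : Real.exp (-(1 / 2) * (Λ * ζ 1) ^ 2) ≤ 1 :=
        Real.exp_le_one_iff.2 (by nlinarith [sq_nonneg (Λ * ζ 1)])
      linarith
    have hw : 0 < |ζ 1| + 1 / L := by positivity
    have hρ : dualGauss ![1, Real.sqrt (1 + Λ ^ 2), L] ζ =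
        dualGauss ![1, 1, L] ζ * Real.exp (-(1 / 2) * (Λ * ζ 1) ^ 2) := by
      rw [dualGauss_eq_mul_exp, Real.sq_sqrt (by positivity)]
      ring_nf
    rw [hρ]
    refine (re_mul_conj_mul_le he hX hw hτ).trans ?_
    refine add_le_add_left ?_ _
    have h1 := high_weight_le (b := ζ 1) hΛ hΛL
    calc _ ≤ τ * (1 / 2 * (‖A j‖ ^ 2 * (dualGauss ![1, 1, L] ζ *
        (8 * ∑ l ∈ Finset.Icc 1 ⌈Λ⌉₊,
          Real.exp (-(1 / 2) * (((l : ℝ) ^ 2 - 1) * ζ 1 ^ 2)))))) := by gcongr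
      _ = _ := by
        rw [Finset.sum_congr rfl fun (l : ℕ) _ => congrArg (‖A j‖ ^ 2 * ·)
          (dualGauss_eq_mul_exp (l : ℝ) L ζ), ← Finset.mul_sum, ← Finset.mul_sum]
        ring
  refine (Finset.sum_le_sum fun j _ => hterm j).trans ?_
  rw [Finset.sum_add_distrib, ← Finset.mul_sum, ← Finset.mul_sum, ← Finset.mul_sum,
    ← Finset.mul_sum]
  refine add_le_add_right ?_ _
  have h2 := sum_dualGauss_mul_le hL hm hm2 ξ
  calc _ ≤ τ⁻¹ * (1 / 2 * (‖B‖ ^ 2 *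
      (1300 * dualGauss (fun _ => 1 / 9) (dualCoord 0 ξ)))) := by gcongr
    _ = _ := by ring

/-- The incidence form of the high-low inequality for Gaussians adapted to the tubes. -/
lemma sum_gauss_le {α β : Type*} {L Λ : ℝ} (hΛ : 1 ≤ Λ) (hΛL : Λ ≤ L) {m : ℕ}
    (hm : ∀ j < m, (j : ℝ) / L ≤ 1) (hm2 : (m : ℝ) ≤ 2 * L) {τ : ℝ} (hτ : 0 < τ)
    (s : Fin m → Finset α) (p : Fin m → α → Fin 3 → ℝ) (Q : Finset β) (y : β → Fin 3 → ℝ) :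
    ∑ j : Fin m, ((1 / L) * (∑ t ∈ s j, ∑ q ∈ Q,
        gauss ![1, 1, L] (coord ((j : ℕ) / L) (p j t - y q))) -
      (1 / (Real.sqrt (1 + Λ ^ 2) * L)) * (∑ t ∈ s j, ∑ q ∈ Q,
        gauss ![1, Real.sqrt (1 + Λ ^ 2), L] (coord ((j : ℕ) / L) (p j t - y q)))) ≤
      4 * τ * (∑ j : Fin m, ∑ l ∈ Finset.Icc 1 ⌈Λ⌉₊, (1 / (l * L)) * (∑ t ∈ s j, ∑ t' ∈ s j,
        gauss ![1, (l : ℝ), L] (coord ((j : ℕ) / L) (p j t - p j t')))) +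
      650 * τ⁻¹ * (729 * ∑ q ∈ Q, ∑ q' ∈ Q, gauss (fun _ => 1 / 9) (coord 0 (y q - y q'))) := by
  have hL0 : 0 < L := by linarith
  have hd : ∀ x : ℝ, 0 < x → ∀ k, 0 < (![1, x, L] : Fin 3 → ℝ) k := by
    intro x hx k; fin_cases k <;> simp [hx, hL0]
  have hd9 : ∀ k : Fin 3, 0 < (fun _ : Fin 3 => (1 / 9 : ℝ)) k := fun k => by norm_num
  have hρ : 0 < Real.sqrt (1 + Λ ^ 2) := Real.sqrt_pos.2 (by positivity)
  have hl : ∀ l ∈ Finset.Icc 1 ⌈Λ⌉₊, (0 : ℝ) < l := fun l hl => by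
    exact_mod_cast (Finset.mem_Icc.1 hl).1
  have hpt : ∀ ξ, _ ≤ _ := fun ξ => sum_re_mul_dualGauss_le hΛ hΛL hm hm2 hτ
    (fun j => expSum (s j) (p j) ξ) (expSum Q y ξ) ξ
  simp only [re_expSum_mul_conj, norm_expSum_sq, mul_sub] at hpt
  have hi1 := fun (j : Fin m) (x : ℝ) (hx : 0 < x) =>
    integrable_sum_cos (s j) (p j) Q y (hd x hx) ((j : ℕ) / L)
  have hi2 := fun (j : Fin m) (x : ℝ) (hx : 0 < x) =>
    integrable_sum_cos (s j) (p j) (s j) (p j) (hd x hx) ((j : ℕ) / L)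
  have hi3 := integrable_sum_cos Q y Q y hd9 0
  have hiS : ∀ j : Fin m, Integrable fun ξ => ∑ l ∈ Finset.Icc 1 ⌈Λ⌉₊,
      (∑ t ∈ s j, ∑ t' ∈ s j, Real.cos (phase (p j t - p j t') ξ)) *
        dualGauss ![1, (l : ℝ), L] (dualCoord ((j : ℕ) / L) ξ) := fun j =>
    integrable_finsetSum _ fun l h => hi2 j l (hl l h)
  have hiSS := integrable_finsetSum Finset.univ fun j (_ : j ∈ Finset.univ) => hiS j
  have hmono := integral_mono
    (integrable_finsetSum Finset.univ fun j _ => (hi1 j 1 one_pos).sub (hi1 j _ hρ))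
    ((hiSS.const_mul (4 * τ)).add (hi3.const_mul (650 * τ⁻¹))) hpt
  rw [integral_finsetSum _ fun j _ => (hi1 j 1 one_pos).sub (hi1 j _ hρ)] at hmono
  simp only [Pi.add_apply, Pi.sub_apply] at hmono
  rw [integral_add (hiSS.const_mul (4 * τ)) (hi3.const_mul (650 * τ⁻¹)),
    integral_const_mul, integral_const_mul, integral_finsetSum _ fun j _ => hiS j,
    integral_sum_cos Q y Q y hd9 0] at hmono
  have e1 : ∀ j : Fin m, _ = _ := fun j => integral_sub (hi1 j 1 one_pos) (hi1 j _ hρ)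
  have e2 : ∀ j : Fin m, _ = _ := fun j =>
    integral_finsetSum (Finset.Icc 1 ⌈Λ⌉₊) fun l h => hi2 j l (hl l h)
  simp only [e1, e2] at hmono
  have e3 : ∀ x : ℝ, ∏ k, (Real.sqrt (2 * Real.pi) / (![1, x, L] : Fin 3 → ℝ) k) =
      Real.sqrt (2 * Real.pi) ^ 3 * (1 / (x * L)) := by
    intro x; simp [Fin.prod_univ_three]; ring
  have e4 : ∏ k : Fin 3, (Real.sqrt (2 * Real.pi) / (fun _ : Fin 3 => (1 / 9 : ℝ)) k) =
      Real.sqrt (2 * Real.pi) ^ 3 * 729 := by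
    simp; ring
  have e5 : ∀ j : Fin m, _ = _ := fun j => integral_sum_cos (s j) (p j) Q y (hd 1 one_pos)
    ((j : ℕ) / L)
  have e6 : ∀ j : Fin m, _ = _ := fun j => integral_sum_cos (s j) (p j) Q y (hd _ hρ)
    ((j : ℕ) / L)
  have e7 : ∀ j : Fin m, ∑ l ∈ Finset.Icc 1 ⌈Λ⌉₊, ∫ ξ,
      (∑ t ∈ s j, ∑ t' ∈ s j, Real.cos (phase (p j t - p j t') ξ)) *
        dualGauss ![1, (l : ℝ), L] (dualCoord ((j : ℕ) / L) ξ) =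
      ∑ l ∈ Finset.Icc 1 ⌈Λ⌉₊, Real.sqrt (2 * Real.pi) ^ 3 * ((1 / (l * L)) *
        (∑ t ∈ s j, ∑ t' ∈ s j,
        gauss ![1, (l : ℝ), L] (coord ((j : ℕ) / L) (p j t - p j t')))) := fun j =>
    Finset.sum_congr rfl fun l h => by
      rw [integral_sum_cos (s j) (p j) (s j) (p j) (hd _ (hl l h)) ((j : ℕ) / L), e3, mul_assoc]
  simp only [e5, e6, e7, e3, e4, one_mul, mul_assoc, ← mul_sub, ← Finset.mul_sum] at hmono
  have hc : 0 < Real.sqrt (2 * Real.pi) ^ 3 := by positivity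
  refine le_of_mul_le_mul_left (hmono.trans_eq' ?_ |>.trans_eq ?_) hc
  · simp only [mul_sub, Finset.mul_sum]
  · simp only [mul_add, Finset.mul_sum]
    congr 1
    · refine Finset.sum_congr rfl fun _ _ => Finset.sum_congr rfl fun _ _ => ?_
      refine Finset.sum_congr rfl fun _ _ => Finset.sum_congr rfl fun _ _ => ?_
      ring
    · refine Finset.sum_congr rfl fun _ _ => Finset.sum_congr rfl fun _ _ => ?_
      ring

lemma gauss_mono_middle {x x' L : ℝ} (hx : 0 < x) (hxx' : x ≤ x') (z : Fin 3 → ℝ) :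
    gauss ![1, x, L] z ≤ gauss ![1, x', L] z := by
  refine Real.exp_le_exp.2 ?_
  have : (z 1 / x') ^ 2 ≤ (z 1 / x) ^ 2 := by
    rw [div_pow, div_pow]; gcongr
  simp [Fin.sum_univ_three]
  linarith

lemma sum_Icc_one_div_le (k : ℕ) : ∑ l ∈ Finset.Icc 1 k, (1 / (l : ℝ)) ≤ 1 + Real.log k := by
  refine le_trans (le_of_eq ?_) (harmonic_le_one_add_log k)
  rw [harmonic_eq_sum_Icc]
  push_cast
  simp

/-- The high-low estimate for the number of `r`-rich points of a family of tubes. -/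
theorem card_mul_sq_le {α β : Type*} {L Λ n r C₁ C₂ c₀ : ℝ} (hΛ : 1 ≤ Λ) (hΛL : Λ ≤ L) {m : ℕ}
    (hm : ∀ j < m, (j : ℝ) / L ≤ 1) (hm2 : (m : ℝ) ≤ 2 * L)
    (s : Fin m → Finset α) (p : Fin m → α → Fin 3 → ℝ) (Q : Finset β) (y : β → Fin 3 → ℝ)
    (hC₂ : 0 < C₂) (hc₀ : 0 < c₀) (hr : 0 < r) (hn : 0 ≤ C₁ * n)
    (hcount : ∀ j x, ∑ t ∈ s j, gauss ![1, 2 * Λ, L] (coord ((j : ℕ) / L) (p j t - x)) ≤ C₁ * n)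
    (hsep : ∀ q ∈ Q, ∑ q' ∈ Q, gauss (fun _ => 1 / 9) (coord 0 (y q - y q')) ≤ C₂)
    (hrich : ∀ q ∈ Q, c₀ * r ≤
      ∑ j, ∑ t ∈ s j, gauss ![1, 1, L] (coord ((j : ℕ) / L) (p j t - y q)))
    (hrn : 4 * (C₁ * n) * L ≤ Λ * (c₀ * r)) :
    (Q.card : ℝ) * r ^ 2 ≤ 64 * (473850 * C₂) / c₀ ^ 2 * (C₁ * n) *
      ((1 + Real.log ⌈Λ⌉₊) * (∑ j, ((s j).card : ℝ)) * L) := by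
  have hΛ0 : 0 < Λ := by linarith
  have hL0 : 0 < L := by linarith
  set D := 473850 * C₂ with hD
  have hD0 : 0 < D := by positivity
  set τ := 4 * D * L / (c₀ * r) with hτ
  have hτ0 : 0 < τ := by positivity
  set H := 1 + Real.log ⌈Λ⌉₊ with hH
  set W := ∑ j, ((s j).card : ℝ) with hW
  have hW0 : 0 ≤ W := Finset.sum_nonneg fun _ _ => Nat.cast_nonneg _
  set ρ := Real.sqrt (1 + Λ ^ 2) with hρdef
  have hρ : Λ ≤ ρ := Real.le_sqrt_of_sq_le (by linarith)
  have hρ0 : 0 < ρ := hΛ0.trans_le hρ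
  have hρ2 : ρ ≤ 2 * Λ := Real.sqrt_le_iff.2 ⟨by positivity, by nlinarith⟩
  have main := sum_gauss_le hΛ hΛL hm hm2 hτ0 s p Q y
  rw [Finset.sum_sub_distrib, ← Finset.mul_sum, ← Finset.mul_sum, ← hρdef] at main
  have hX : (Q.card : ℝ) * (c₀ * r) ≤ ∑ j, ∑ t ∈ s j, ∑ q ∈ Q,
      gauss ![1, 1, L] (coord ((j : ℕ) / L) (p j t - y q)) := by
    have h1 : ∀ j : Fin m, _ = _ := fun j => Finset.sum_comm (s := s j) (t := Q)
      (f := fun t q => gauss ![1, 1, L] (coord ((j : ℕ) / L) (p j t - y q)))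
    simp only [h1]
    rw [Finset.sum_comm, ← nsmul_eq_mul]
    exact Finset.card_nsmul_le_sum _ _ _ hrich
  have hlow : ∑ j, ∑ t ∈ s j, ∑ q ∈ Q,
      gauss ![1, ρ, L] (coord ((j : ℕ) / L) (p j t - y q)) ≤ (2 * L) * (Q.card * (C₁ * n)) := by
    have h1 : ∀ j : Fin m, ∑ t ∈ s j, ∑ q ∈ Q,
        gauss ![1, ρ, L] (coord ((j : ℕ) / L) (p j t - y q)) ≤ Q.card * (C₁ * n) := by
      intro j
      rw [Finset.sum_comm, ← nsmul_eq_mul]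
      refine Finset.sum_le_card_nsmul _ _ _ fun q _ => le_trans ?_ (hcount j (y q))
      exact Finset.sum_le_sum fun t _ => gauss_mono_middle hρ0 hρ2 _
    calc _ ≤ ∑ j : Fin m, Q.card * (C₁ * n) := Finset.sum_le_sum fun j _ => h1 j
      _ = m * (Q.card * (C₁ * n)) := by simp
      _ ≤ _ := by gcongr
  have hE : ∑ j : Fin m, ∑ l ∈ Finset.Icc 1 ⌈Λ⌉₊, (1 / (l * L)) * (∑ t ∈ s j, ∑ t' ∈ s j,
        gauss ![1, (l : ℝ), L] (coord ((j : ℕ) / L) (p j t - p j t'))) ≤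
      W * (C₁ * n) * H / L := by
    have h1 : ∀ j : Fin m, ∀ l ∈ Finset.Icc 1 ⌈Λ⌉₊,
        (1 / (l * L)) * (∑ t ∈ s j, ∑ t' ∈ s j,
        gauss ![1, (l : ℝ), L] (coord ((j : ℕ) / L) (p j t - p j t'))) ≤
        (1 / (l : ℝ)) * (((s j).card : ℝ) * (C₁ * n) / L) := by
      intro j l hl
      have hl0 : (0 : ℝ) < l := by exact_mod_cast (Finset.mem_Icc.1 hl).1
      have hl2 : (l : ℝ) ≤ 2 * Λ := by
        have h2 : (l : ℝ) ≤ ⌈Λ⌉₊ := by exact_mod_cast (Finset.mem_Icc.1 hl).2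
        have h3 := Nat.ceil_lt_add_one hΛ0.le
        linarith
      have h2 : ∑ t ∈ s j, ∑ t' ∈ s j,
          gauss ![1, (l : ℝ), L] (coord ((j : ℕ) / L) (p j t - p j t')) ≤
          (s j).card * (C₁ * n) := by
        rw [Finset.sum_comm, ← nsmul_eq_mul]
        refine Finset.sum_le_card_nsmul _ _ _ fun t _ => le_trans ?_ (hcount j (p j t))
        exact Finset.sum_le_sum fun t _ => gauss_mono_middle hl0 hl2 _
      calc _ ≤ (1 / (l * L)) * ((s j).card * (C₁ * n)) := by gcongr
        _ = _ := by field_simp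
    calc _ ≤ ∑ j : Fin m, ∑ l ∈ Finset.Icc 1 ⌈Λ⌉₊,
          (1 / (l : ℝ)) * (((s j).card : ℝ) * (C₁ * n) / L) :=
          Finset.sum_le_sum fun j _ => Finset.sum_le_sum (h1 j)
      _ = (∑ l ∈ Finset.Icc 1 ⌈Λ⌉₊, (1 / (l : ℝ))) * (W * (C₁ * n) / L) := by
          rw [show W * (C₁ * n) / L = ∑ j, ((s j).card : ℝ) * (C₁ * n) / L by
            rw [hW, Finset.sum_mul, Finset.sum_div], Finset.sum_mul_sum, Finset.sum_comm]
      _ ≤ H * (W * (C₁ * n) / L) :=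
          mul_le_mul_of_nonneg_right (sum_Icc_one_div_le _)
            (div_nonneg (mul_nonneg hW0 hn) hL0.le)
      _ = _ := by ring
  have hDQ : ∑ q ∈ Q, ∑ q' ∈ Q, gauss (fun _ => 1 / 9) (coord 0 (y q - y q')) ≤
      Q.card * C₂ := by
    rw [← nsmul_eq_mul]
    exact Finset.sum_le_card_nsmul _ _ _ hsep
  have hX' : (1 / L) * ((Q.card : ℝ) * (c₀ * r)) ≤ (1 / L) * ∑ j, ∑ t ∈ s j, ∑ q ∈ Q,
      gauss ![1, 1, L] (coord ((j : ℕ) / L) (p j t - y q)) := by gcongr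
  have hlow' : (1 / (ρ * L)) * ∑ j, ∑ t ∈ s j, ∑ q ∈ Q,
      gauss ![1, ρ, L] (coord ((j : ℕ) / L) (p j t - y q)) ≤
      Q.card * (c₀ * r) / (2 * L) := by
    calc _ ≤ (1 / (ρ * L)) * ((2 * L) * (Q.card * (C₁ * n))) := by gcongr
      _ ≤ (1 / (Λ * L)) * ((2 * L) * (Q.card * (C₁ * n))) := by gcongr
      _ = (Q.card / (2 * Λ * L)) * (4 * (C₁ * n) * L) := by field_simp; ring
      _ ≤ (Q.card / (2 * Λ * L)) * (Λ * (c₀ * r)) := by gcongr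
      _ = _ := by field_simp
  have hE' := mul_le_mul_of_nonneg_left hE (by positivity : 0 ≤ 4 * τ)
  have hD' : 650 * τ⁻¹ *
      (729 * ∑ q ∈ Q, ∑ q' ∈ Q, gauss (fun _ => 1 / 9) (coord 0 (y q - y q'))) ≤
      Q.card * (c₀ * r) / (4 * L) := by
    calc _ ≤ 650 * τ⁻¹ * (729 * (Q.card * C₂)) := by gcongr
      _ = _ := by rw [hτ, hD]; field_simp; ring
  have hfin : (Q.card : ℝ) * (c₀ * r) / (4 * L) ≤ 4 * τ * (W * (C₁ * n) * H / L) := by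
    have e1 : (1 / L) * ((Q.card : ℝ) * (c₀ * r)) = 4 * (Q.card * (c₀ * r) / (4 * L)) := by
      field_simp
    have e2 : (Q.card : ℝ) * (c₀ * r) / (2 * L) = 2 * (Q.card * (c₀ * r) / (4 * L)) := by
      ring
    linarith
  have hfin2 := mul_le_mul_of_nonneg_left hfin (by positivity : 0 ≤ 4 * L * r / c₀)
  calc (Q.card : ℝ) * r ^ 2 = 4 * L * r / c₀ * (Q.card * (c₀ * r) / (4 * L)) := by field_simp
    _ ≤ _ := hfin2
    _ = _ := by rw [hτ]; field_simp; ring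

lemma sum_int_one_div_le {K A : ℝ} (hK : 1 ≤ K) (hA : 1 ≤ A) (x : ℝ) (S : Finset ℤ) :
    ∑ a ∈ S, 1 / (1 + ((a / K - x) / A) ^ 2) ≤ 16 * K * A := by
  have hKA : 1 ≤ K * A := by nlinarith
  have hK0 : 0 < K := by linarith
  have hA0 : 0 < A := by linarith
  set u : ℤ → ℝ := fun a => (a / K - x) / A with hu
  have hstep : ∀ a : ℤ, u (a + 1) = u a + 1 / (K * A) := by
    intro a; simp only [hu]; push_cast; field_simp; ring
  have hmono : ∀ a : ℤ, Real.arctan (u a) ≤ Real.arctan (u (a + 1)) := fun a =>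
    Real.arctan_strictMono.monotone (by rw [hstep]; linarith [show 0 < 1 / (K * A) by positivity])
  have hterm : ∀ a : ℤ, 1 / (1 + (u a) ^ 2) ≤
      4 * (K * A) * (Real.arctan (u (a + 1)) - Real.arctan (u a)) := by
    intro a
    have h1 := abs_div_one_add_sq_le (u a) (1 / (K * A))
    rw [← hstep, abs_of_pos (by positivity), abs_of_nonneg (by linarith [hmono a])] at h1
    have h2 : 1 + (1 / (K * A)) ^ 2 ≤ 2 := by
      have : (1 / (K * A)) ^ 2 ≤ 1 := pow_le_one₀ (by positivity) (by
        rw [div_le_one (by positivity)]; exact hKA)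
      linarith
    have h3 : 0 ≤ Real.arctan (u (a + 1)) - Real.arctan (u a) := by linarith [hmono a]
    calc 1 / (1 + (u a) ^ 2) = (K * A) * (1 / (K * A) / (1 + (u a) ^ 2)) := by field_simp
      _ ≤ (K * A) * (2 * (1 + (1 / (K * A)) ^ 2) *
          (Real.arctan (u (a + 1)) - Real.arctan (u a))) := by gcongr
      _ ≤ (K * A) * (2 * 2 * (Real.arctan (u (a + 1)) - Real.arctan (u a))) := by gcongr
      _ = _ := by ring
  obtain ⟨M, hM⟩ : ∃ M : ℕ, ∀ a ∈ S, -(M : ℤ) ≤ a ∧ a < M := by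
    refine ⟨∑ a ∈ S, (a.natAbs + 1), fun a ha => ?_⟩
    have := Finset.single_le_sum (f := fun a : ℤ => a.natAbs + 1) (fun _ _ => Nat.zero_le _) ha
    omega
  have hsub : S ⊆ (Finset.range (2 * M)).image fun i : ℕ => (i : ℤ) - M := by
    intro a ha
    have := hM a ha
    refine Finset.mem_image.2 ⟨(a + M).toNat, ?_, ?_⟩
    · simp; omega
    · omega
  have htel : ∑ i ∈ Finset.range (2 * M),
      (Real.arctan (u ((i : ℤ) - M + 1)) - Real.arctan (u ((i : ℤ) - M))) ≤ 4 := by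
    have := Finset.sum_range_sub (fun i : ℕ => Real.arctan (u ((i : ℤ) - M))) (2 * M)
    have e : ∀ i : ℕ, ((i + 1 : ℕ) : ℤ) - M = (i : ℤ) - M + 1 := fun i => by push_cast; ring
    simp only [e] at this
    rw [this]
    refine (sub_le_sub (Real.arctan_lt_pi_div_two _).le
      (Real.neg_pi_div_two_lt_arctan _).le).trans ?_
    linarith [Real.pi_lt_four]
  calc ∑ a ∈ S, 1 / (1 + (u a) ^ 2)
      ≤ ∑ a ∈ (Finset.range (2 * M)).image (fun i : ℕ => (i : ℤ) - M), 1 / (1 + (u a) ^ 2) :=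
        Finset.sum_le_sum_of_subset_of_nonneg hsub fun _ _ _ => by positivity
    _ = ∑ i ∈ Finset.range (2 * M), 1 / (1 + (u ((i : ℤ) - M)) ^ 2) :=
        Finset.sum_image fun a _ b _ h => by simpa using h
    _ ≤ ∑ i ∈ Finset.range (2 * M), 4 * (K * A) *
        (Real.arctan (u ((i : ℤ) - M + 1)) - Real.arctan (u ((i : ℤ) - M))) :=
        Finset.sum_le_sum fun i _ => hterm _
    _ ≤ 4 * (K * A) * 4 := by rw [← Finset.mul_sum]; gcongr
    _ = _ := by ring

/-- Rapidly decaying sums over points around which small boxes have bounded overlap. -/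
lemma sum_prod_one_div_le {ι : Type*} (s : Finset ι) (z : ι → Fin 3 → ℝ) {K : ℝ} {N : ℕ}
    (hK : 1 ≤ K)
    (hz : ∀ (w : Fin 3 → ℝ) (s' : Finset ι), s' ⊆ s → (∀ i ∈ s', ∀ k, |w k - z i k| ≤ 1 / K) →
      s'.card ≤ N) {A : Fin 3 → ℝ} (hA : ∀ k, 1 ≤ A k) (x : Fin 3 → ℝ) :
    ∑ i ∈ s, ∏ k, 1 / (1 + ((z i k - x k) / A k) ^ 2) ≤ 64 * (16 * K) ^ 3 * N * ∏ k, A k := by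
  classical
  have hK0 : 0 < K := by linarith
  set f : ι → Fin 3 → ℤ := fun i k => ⌊K * z i k⌋ with hf
  set ψ : Fin 3 → ℤ → ℝ := fun k a => 1 / (1 + ((a / K - x k) / A k) ^ 2) with hψ
  have hψ0 : ∀ k a, 0 ≤ ψ k a := fun k a => by simp only [hψ]; positivity
  have hcell : ∀ i k, |(f i k : ℝ) / K - z i k| ≤ 1 / K := by
    intro i k
    have h1 := Int.floor_le (K * z i k)
    have h2 := Int.lt_floor_add_one (K * z i k)
    have e : (f i k : ℝ) / K - z i k = (f i k - K * z i k) / K := by field_simp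
    rw [e, abs_div, abs_of_pos hK0]
    gcongr
    rw [abs_le]
    constructor <;> simp only [hf] <;> linarith
  have hterm : ∀ i, ∏ k, 1 / (1 + ((z i k - x k) / A k) ^ 2) ≤ 64 * ∏ k, ψ k (f i k) := by
    intro i
    have h1 : ∀ k, 1 / (1 + ((z i k - x k) / A k) ^ 2) ≤ 4 * ψ k (f i k) := by
      intro k
      have hA0 : 0 < A k := by linarith [hA k]
      have h2 := one_div_one_add_sq_add_le (((f i k : ℝ) / K - x k) / A k)
        ((z i k - (f i k : ℝ) / K) / A k)
      rw [← add_div, show (f i k : ℝ) / K - x k + (z i k - (f i k : ℝ) / K) = z i k - x k by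
        ring] at h2
      refine h2.trans ?_
      have h3 : ((z i k - (f i k : ℝ) / K) / A k) ^ 2 ≤ 1 := by
        rw [← sq_abs, abs_div, abs_of_pos hA0, abs_sub_comm]
        refine pow_le_one₀ (by positivity) ?_
        rw [div_le_one hA0]
        have : 1 / K ≤ 1 := by rw [div_le_one hK0]; exact hK
        linarith [hcell i k, hA k]
      have h4 := hψ0 k (f i k)
      simp only [hψ] at h4 ⊢
      nlinarith
    calc _ ≤ ∏ k, 4 * ψ k (f i k) := Finset.prod_le_prod (fun k _ => by positivity) fun k _ => h1 k
      _ = _ := by rw [Finset.prod_mul_distrib]; norm_num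
  set S : Fin 3 → Finset ℤ := fun k => s.image fun i => f i k with hS
  have hmaps : ∀ i ∈ s, f i ∈ Fintype.piFinset S := fun i hi =>
    Fintype.mem_piFinset.2 fun k => Finset.mem_image_of_mem _ hi
  calc ∑ i ∈ s, ∏ k, 1 / (1 + ((z i k - x k) / A k) ^ 2)
      ≤ ∑ i ∈ s, 64 * ∏ k, ψ k (f i k) := Finset.sum_le_sum fun i _ => hterm i
    _ = ∑ a ∈ Fintype.piFinset S, ∑ i ∈ s with f i = a, 64 * ∏ k, ψ k (f i k) :=
        (Finset.sum_fiberwise_of_maps_to hmaps _).symm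
    _ ≤ ∑ a ∈ Fintype.piFinset S, N * (64 * ∏ k, ψ k (a k)) := by
        refine Finset.sum_le_sum fun a _ => ?_
        have h1 : ∑ i ∈ s with f i = a, 64 * ∏ k, ψ k (f i k) =
            ∑ i ∈ s with f i = a, 64 * ∏ k, ψ k (a k) :=
          Finset.sum_congr rfl fun i hi => by rw [(Finset.mem_filter.1 hi).2]
        rw [h1, Finset.sum_const, nsmul_eq_mul]
        have h2 : (Finset.filter (fun i => f i = a) s).card ≤ N :=
          hz (fun k => (a k : ℝ) / K) _ (Finset.filter_subset _ _) fun i hi k => by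
            rw [← (Finset.mem_filter.1 hi).2]; exact hcell i k
        have h3 : 0 ≤ 64 * ∏ k, ψ k (a k) :=
          mul_nonneg (by norm_num) (Finset.prod_nonneg fun k _ => hψ0 k _)
        gcongr
    _ = 64 * N * ∏ k, ∑ a ∈ S k, ψ k a := by
        rw [Finset.prod_univ_sum, Finset.mul_sum]
        exact Finset.sum_congr rfl fun _ _ => by ring
    _ ≤ 64 * N * ∏ k, (16 * K * A k) := by
        refine mul_le_mul_of_nonneg_left ?_ (by positivity)
        exact Finset.prod_le_prod (fun k _ => Finset.sum_nonneg fun a _ => hψ0 k a)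
          fun k _ => sum_int_one_div_le hK (hA k) _ _
    _ = _ := by
        rw [Finset.prod_mul_distrib]
        simp only [Finset.prod_const, Finset.card_univ, Fintype.card_fin]
        ring

/-- The point `x`, rescaled by `ℓ⁻¹`. -/
noncomputable def rescale (ℓ : ℝ) (x : E3) : Fin 3 → ℝ := fun k => x k / ℓ

lemma abs_coord_sub_le_iff {ℓ : ℝ} (hℓ : 0 < ℓ) (c : ℝ) (v x : E3) (e : Fin 3 → ℝ) :
    (∀ k, |coord c (rescale ℓ x) k - coord c (rescale ℓ v) k| ≤ e k) ↔
      x ∈ frenetBox c v (ℓ * e 0) (ℓ * e 1) (ℓ * e 2) := by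
  have key : ∀ a b d : ℝ, a = b / ℓ → (|a| ≤ d ↔ |b| ≤ ℓ * d) := by
    intro a b d h
    rw [h, abs_div, abs_of_pos hℓ, div_le_iff₀ hℓ, mul_comm]
  rw [Fin.forall_fin_succ, Fin.forall_fin_succ, Fin.forall_fin_succ]
  simp only [frenetBox, Set.mem_ofPred_eq]
  refine and_congr (key _ _ _ ?_) (and_congr (key _ _ _ ?_) ((and_iff_left (by simp)).trans
    (key _ _ _ ?_)))
  · simp [coord, rescale]; ring
  · simp [coord, rescale]; ring
  · simp [coord, rescale]; ring

lemma exists_coord_rescale_eq {ℓ : ℝ} (hℓ : 0 < ℓ) (c : ℝ) (w : Fin 3 → ℝ) :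
    ∃ x : E3, coord c (rescale ℓ x) = w := by
  refine ⟨!₂[ℓ * (w 0 - 2 * c * (w 1 - 3 * c * w 2) - 3 * c ^ 2 * w 2),
    ℓ * (w 1 - 3 * c * w 2), ℓ * w 2], ?_⟩
  ext k
  fin_cases k <;> simp [coord, rescale] <;> field_simp <;> ring

lemma gauss_le_prod (e z : Fin 3 → ℝ) :
    gauss e z ≤ 8 * ∏ k, 1 / (1 + (z k / e k) ^ 2) := by
  have h1 : ∀ x : ℝ, Real.exp (-(1 / 2) * x ^ 2) ≤ 2 * (1 / (1 + x ^ 2)) := by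
    intro x
    rw [show -(1 / 2) * x ^ 2 = -(x ^ 2 / 2) by ring, Real.exp_neg,
      show 2 * (1 / (1 + x ^ 2)) = ((1 + x ^ 2) / 2)⁻¹ by rw [inv_div]; ring]
    refine inv_anti₀ (by positivity) ?_
    linarith [Real.add_one_le_exp (x ^ 2 / 2)]
  rw [gauss, Finset.mul_sum, Real.exp_sum]
  calc _ ≤ ∏ k, 2 * (1 / (1 + (z k / e k) ^ 2)) :=
        Finset.prod_le_prod (fun k _ => (Real.exp_pos _).le) fun k _ => h1 _
    _ = _ := by rw [Finset.prod_mul_distrib]; norm_num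

/-- A box contains the `K⁻¹`-dilate and is contained in the `K`-dilate of a model box. -/
lemma exists_center_of_isFrenetBox {K : ℕ} {ℓ c d₁ d₂ d₃ : ℝ} {D : Fin 3 → ℝ} {B : Set E3}
    (hB : IsFrenetBox K c d₁ d₂ d₃ B) (hℓ : 0 < ℓ) (h₁ : d₁ = ℓ * D 0)
    (h₂ : d₂ = ℓ * D 1) (h₃ : d₃ = ℓ * D 2) :
    ∃ v : E3, (∀ x : E3, (∀ k, |coord c (rescale ℓ x) k - coord c (rescale ℓ v) k| ≤ D k / K) →
      x ∈ B) ∧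
      ∀ x ∈ B, ∀ k, |coord c (rescale ℓ x) k - coord c (rescale ℓ v) k| ≤ K * D k := by
  obtain ⟨v, hv1, hv2⟩ := hB
  subst h₁ h₂ h₃
  refine ⟨v, fun x hx => hv1 ?_, fun x hx => ?_⟩
  · have := (abs_coord_sub_le_iff hℓ c v x fun k => D k / K).1 hx
    simpa only [mul_div_assoc] using this
  · refine (abs_coord_sub_le_iff hℓ c v x fun k => K * D k).2 ?_
    have := hv2 hx
    simpa only [mul_left_comm] using this

/-- If each box contains at most `n` members of the family `s`, then Gaussian sums over `s`
adapted to larger boxes are controlled. -/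
lemma sum_gauss_le_of_boxes {K n : ℕ} (hK : 1 ≤ K) {ℓ c : ℝ} (hℓ : 0 < ℓ) {D e : Fin 3 → ℝ}
    (hD : ∀ k, 0 < D k) (hDe : ∀ k, D k ≤ e k) {d₁ d₂ d₃ : ℝ} (h₁ : d₁ = ℓ * D 0)
    (h₂ : d₂ = ℓ * D 1) (h₃ : d₃ = ℓ * D 2) (s : Finset (Set E3))
    {p : Set E3 → E3} (hp : ∀ t ∈ s, p t ∈ t) {F : Set (Set E3)}
    (hF : ∀ B ∈ F, IsFrenetBox K c d₁ d₂ d₃ B) (hover : BoundedOverlap K F)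
    (hcov : ∀ t ∈ s, ∃ B ∈ F, t ⊆ B) (hn : ∀ B ∈ F, {t | t ∈ s ∧ t ⊆ B}.ncard ≤ n)
    (x : Fin 3 → ℝ) :
    ∑ t ∈ s, gauss e (coord c (rescale ℓ (p t) - x)) ≤
      8 * (2 * (1 + (K : ℝ) ^ 2)) ^ 3 * (64 * (16 * K) ^ 3 * K) * (∏ k, e k / D k) * n := by
  classical
  have hK1 : (1 : ℝ) ≤ K := by exact_mod_cast hK
  have he : ∀ k, 0 < e k := fun k => (hD k).trans_le (hDe k)
  choose! bx hbx hsub using hcov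
  choose! v hv1 hv2 using fun B hB => exists_center_of_isFrenetBox (D := D) (hF B hB) hℓ h₁ h₂ h₃
  set u := coord c x with hu
  set w : Set E3 → Fin 3 → ℝ := fun B => coord c (rescale ℓ (v B)) with hw
  set G : Set E3 → ℝ := fun B => ∏ k, 1 / (1 + ((w B k - u k) / e k) ^ 2) with hG
  have hG0 : ∀ B, 0 ≤ G B := fun B => Finset.prod_nonneg fun k _ => by positivity
  set M : ℝ := 8 * (2 * (1 + (K : ℝ) ^ 2)) ^ 3 with hM
  have hM0 : 0 ≤ M := by positivity
  have hterm : ∀ t ∈ s, gauss e (coord c (rescale ℓ (p t) - x)) ≤ M * G (bx t) := by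
    intro t ht
    refine (gauss_le_prod _ _).trans ?_
    have h1 : ∀ k, 1 / (1 + (coord c (rescale ℓ (p t) - x) k / e k) ^ 2) ≤
        2 * (1 + (K : ℝ) ^ 2) * (1 / (1 + ((w (bx t) k - u k) / e k) ^ 2)) := by
      intro k
      set z := coord c (rescale ℓ (p t)) k - w (bx t) k with hz
      have h2 := one_div_one_add_sq_add_le ((w (bx t) k - u k) / e k) (z / e k)
      rw [← add_div, show w (bx t) k - u k + z = coord c (rescale ℓ (p t) - x) k by
        rw [coord_sub, Pi.sub_apply]; ring] at h2
      refine h2.trans ?_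
      have h3 : |z / e k| ≤ K := by
        rw [abs_div, abs_of_pos (he k), div_le_iff₀ (he k)]
        exact (hv2 _ (hbx t ht) _ (hsub t ht (hp t ht)) k).trans (by gcongr; exact hDe k)
      have h4 : (z / e k) ^ 2 ≤ (K : ℝ) ^ 2 := by
        rw [← sq_abs]; exact pow_le_pow_left₀ (abs_nonneg _) h3 2
      gcongr
    calc _ ≤ 8 * ∏ k, 2 * (1 + (K : ℝ) ^ 2) * (1 / (1 + ((w (bx t) k - u k) / e k) ^ 2)) := by
          gcongr
          exact h1 _
      _ = M * G (bx t) := by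
          rw [Finset.prod_mul_distrib, hM, hG]; simp [mul_assoc]
  have hsum := sum_prod_one_div_le (s.image bx) (fun B k => w B k / D k) (N := K) hK1
    (by
      intro a s' hs' ha
      obtain ⟨y, hy⟩ := exists_coord_rescale_eq hℓ c fun k => a k * D k
      have h1 : (s' : Set (Set E3)) ⊆ {B | B ∈ F ∧ y ∈ B} := by
        intro B hB
        obtain ⟨t, ht, rfl⟩ := Finset.mem_image.1 (hs' hB)
        refine ⟨hbx t ht, hv1 _ (hbx t ht) y fun k => ?_⟩
        have h2 := ha _ hB k
        have h3 : coord c (rescale ℓ y) k - w (bx t) k = (a k - w (bx t) k / D k) * D k := by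
          rw [hy, sub_mul, div_mul_cancel₀ _ (hD k).ne']
        have : |coord c (rescale ℓ y) k - w (bx t) k| ≤ D k / K := by
          rw [h3, abs_mul, abs_of_pos (hD k)]
          exact (mul_le_mul_of_nonneg_right h2 (hD k).le).trans_eq (one_div_mul_eq_div _ _)
        exact this
      have h4 := (Set.encard_le_encard h1).trans (hover y)
      rw [Set.encard_coe_eq_coe_finsetCard] at h4
      exact_mod_cast h4)
    (A := fun k => e k / D k) (fun k => (one_le_div (hD k)).2 (hDe k)) (fun k => u k / D k)
  have hsum' : ∑ B ∈ s.image bx, G B ≤ 64 * (16 * K) ^ 3 * K * ∏ k, e k / D k := by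
    refine le_of_eq_of_le (Finset.sum_congr rfl fun B _ => Finset.prod_congr rfl fun k _ => ?_) hsum
    rw [← sub_div, div_div_div_cancel_right₀ (hD k).ne']
  calc _ ≤ ∑ t ∈ s, M * G (bx t) := Finset.sum_le_sum hterm
    _ = ∑ B ∈ s.image bx, ∑ t ∈ s with bx t = B, M * G (bx t) :=
        (Finset.sum_fiberwise_of_maps_to (fun t ht => Finset.mem_image_of_mem _ ht) _).symm
    _ ≤ ∑ B ∈ s.image bx, n * (M * G B) := by
        refine Finset.sum_le_sum fun B hB => ?_
        obtain ⟨t₀, ht₀, rfl⟩ := Finset.mem_image.1 hB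
        have h1 : ∑ t ∈ s with bx t = bx t₀, M * G (bx t) =
            ∑ t ∈ s with bx t = bx t₀, M * G (bx t₀) :=
          Finset.sum_congr rfl fun i hi => by rw [(Finset.mem_filter.1 hi).2]
        rw [h1, Finset.sum_const, nsmul_eq_mul]
        refine mul_le_mul_of_nonneg_right ?_ (mul_nonneg hM0 (hG0 _))
        have h2 : (Finset.filter (fun t => bx t = bx t₀) s).card ≤ n := by
          refine le_trans ?_ (hn _ (hbx t₀ ht₀))
          rw [← Set.ncard_coe_finset]
          refine Set.ncard_le_ncard ?_ (s.finite_toSet.subset fun t ht => ht.1)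
          intro t ht
          have ht' := Finset.mem_filter.1 (Finset.mem_coe.1 ht)
          exact ⟨ht'.1, ht'.2 ▸ hsub t ht'.1⟩
        exact_mod_cast h2
    _ = n * M * ∑ B ∈ s.image bx, G B := by
        rw [Finset.mul_sum]; exact Finset.sum_congr rfl fun _ _ => by ring
    _ ≤ n * M * (64 * (16 * K) ^ 3 * K * ∏ k, e k / D k) := by gcongr
    _ = _ := by ring

lemma exists_center_of_isCubeOfSide {s : ℝ} {q : Set E3} (hs : 0 < s) (hq : IsCubeOfSide s q) :
    ∃ y : E3, Metric.ball y (s / 2) ⊆ interior q ∧ ∀ x ∈ q, ∀ k, |x k - y k| ≤ s := by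
  obtain ⟨φ, rfl⟩ := hq
  have hcoord : ∀ (z : E3) k, |z k| ≤ ‖z‖ := fun z k => PiLp.norm_apply_le z k
  refine ⟨φ 0, ?_, ?_⟩
  · refine interior_maximal ?_ Metric.isOpen_ball
    intro x hx
    refine ⟨φ.symm x, fun k => ?_, by simp⟩
    refine (hcoord _ k).trans ?_
    rw [Metric.mem_ball] at hx
    have : dist (φ.symm x) 0 = dist x (φ 0) := by
      rw [← φ.isometry.dist_eq, φ.apply_symm_apply]
    rw [← dist_zero_right, this]
    exact hx.le
  · rintro x ⟨z, hz, rfl⟩ k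
    have h1 : ‖φ z - φ 0‖ = ‖z‖ := by
      rw [← dist_eq_norm, φ.isometry.dist_eq, dist_zero_right]
    have h2 : ‖z‖ ≤ s := by
      rw [EuclideanSpace.norm_eq]
      refine Real.sqrt_le_iff.2 ⟨hs.le, ?_⟩
      have h3 : ∀ k, ‖z k‖ ^ 2 ≤ (s / 2) ^ 2 := fun k =>
        pow_le_pow_left₀ (norm_nonneg _) (hz k) 2
      rw [Fin.sum_univ_three]
      nlinarith [h3 0, h3 1, h3 2, sq_nonneg s]
    have h4 := hcoord (φ z - φ 0) k
    rw [h1, PiLp.sub_apply] at h4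
    exact h4.trans h2

/-- Centers of pairwise disjoint cubes of comparable sizes are separated. -/
lemma exists_centers_of_isRichCubeFamily {K : ℕ} {R r : ℝ} {n : ℕ} {T : Fin n → Finset (Set E3)}
    {Q : Finset (Set E3)} (hQ : IsRichCubeFamily K R r T Q) (hK : 1 ≤ K) (hR : 0 < R) :
    ∃ y : Set E3 → E3, (∀ q ∈ Q, ∀ x ∈ q, ∀ k, |x k - y q k| ≤ K * R ^ ((2 : ℝ) / 3)) ∧
      ∀ q ∈ Q, ∀ q' ∈ Q, q ≠ q' → R ^ ((2 : ℝ) / 3) / (2 * K) ≤ dist (y q) (y q') := by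
  have hK0 : (0 : ℝ) < K := by exact_mod_cast hK
  have hℓ : 0 < R ^ ((2 : ℝ) / 3) := Real.rpow_pos_of_pos hR _
  have h : ∀ q ∈ Q, ∃ y : E3, Metric.ball y (R ^ ((2 : ℝ) / 3) / (2 * K)) ⊆ interior q ∧
      ∀ x ∈ q, ∀ k, |x k - y k| ≤ K * R ^ ((2 : ℝ) / 3) := by
    intro q hq
    obtain ⟨⟨s, hs1, hs2, hs⟩, -⟩ := hQ.1 q hq
    have hs0 : 0 < s := lt_of_lt_of_le (by positivity) hs1
    obtain ⟨y, hy1, hy2⟩ := exists_center_of_isCubeOfSide hs0 hs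
    refine ⟨y, (Metric.ball_subset_ball ?_).trans hy1, fun x hx k => (hy2 x hx k).trans hs2⟩
    rw [mul_comm, ← div_div]
    linarith
  choose! y hy1 hy2 using h
  refine ⟨y, hy2, fun q hq q' hq' hne => ?_⟩
  by_contra! hlt
  have h1 : y q' ∈ interior q := hy1 q hq (by rwa [Metric.mem_ball, dist_comm])
  have h2 : y q' ∈ interior q' := hy1 q' hq' (Metric.mem_ball_self (by positivity))
  exact Set.disjoint_left.1 (hQ.2 q hq q' hq' hne) h1 h2

/-- Rapidly decaying sums over separated points are bounded, in any Frenet coordinates. -/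
lemma sum_prod_le_of_separated {K : ℕ} (hK : 1 ≤ K) {ℓ c : ℝ} (hℓ : 0 < ℓ) (h0 : 0 ≤ c)
    (h1 : c ≤ 1) (Q : Finset (Set E3)) {y : Set E3 → E3}
    (hy : ∀ q ∈ Q, ∀ q' ∈ Q, q ≠ q' → ℓ / (2 * K) ≤ dist (y q) (y q')) {A : Fin 3 → ℝ}
    (hA : ∀ k, 1 ≤ A k) (x : Fin 3 → ℝ) :
    ∑ q ∈ Q, ∏ k, 1 / (1 + ((coord c (rescale ℓ (y q)) k - x k) / A k) ^ 2) ≤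
      64 * (1600 * K) ^ 3 * ∏ k, A k := by
  have hK1 : (1 : ℝ) ≤ K := by exact_mod_cast hK
  have hK0 : (0 : ℝ) < K := by linarith
  have h := sum_prod_one_div_le Q (fun q => coord c (rescale ℓ (y q))) (K := 100 * K) (N := 1)
    (by linarith) (by
      intro w s' hs' hw
      refine Finset.card_le_one.2 fun q hq q' hq' => ?_
      by_contra hne
      have hd := hy q (hs' hq) q' (hs' hq') hne
      have h2 : ∀ k, |coord c (rescale ℓ (y q)) k - coord c (rescale ℓ (y q')) k| ≤
          2 * (1 / (100 * K)) := by
        intro k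
        have e : coord c (rescale ℓ (y q)) k - coord c (rescale ℓ (y q')) k =
          (w k - coord c (rescale ℓ (y q')) k) - (w k - coord c (rescale ℓ (y q)) k) := by ring
        rw [e]
        exact (abs_sub _ _).trans (by linarith [hw q hq k, hw q' hq' k])
      set δ := 2 * (1 / (100 * (K : ℝ))) with hδ
      have hδ0 : 0 < δ := by positivity
      set a := fun k => (y q k - y q' k) / ℓ with ha
      have k2 : |a 2| ≤ δ := by
        have := h2 2; simpa [coord, rescale, ha, sub_div] using this
      have k1 : |a 1 + 3 * c * a 2| ≤ δ := by
        have := h2 1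
        rwa [show coord c (rescale ℓ (y q)) 1 - coord c (rescale ℓ (y q')) 1 =
          a 1 + 3 * c * a 2 by simp [coord, rescale, ha]; ring] at this
      have k0 : |a 0 + 2 * c * a 1 + 3 * c ^ 2 * a 2| ≤ δ := by
        have := h2 0
        rwa [show coord c (rescale ℓ (y q)) 0 - coord c (rescale ℓ (y q')) 0 =
          a 0 + 2 * c * a 1 + 3 * c ^ 2 * a 2 by simp [coord, rescale, ha]; ring] at this
      have hca2 : |c * a 2| ≤ δ := by
        rw [abs_mul, abs_of_nonneg h0]
        exact (mul_le_of_le_one_left (abs_nonneg _) h1).trans k2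
      have hc2a2 : |c ^ 2 * a 2| ≤ δ := by
        rw [abs_mul, abs_of_nonneg (sq_nonneg c)]
        exact (mul_le_of_le_one_left (abs_nonneg _) (pow_le_one₀ h0 h1)).trans k2
      have m1 : |a 1| ≤ 4 * δ := by
        rw [abs_le] at *
        constructor <;> linarith [k1.1, k1.2, hca2.1, hca2.2]
      have hca1 : |c * a 1| ≤ 4 * δ := by
        rw [abs_mul, abs_of_nonneg h0]
        exact (mul_le_of_le_one_left (abs_nonneg _) h1).trans m1
      have m0 : |a 0| ≤ 12 * δ := by
        rw [abs_le] at *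
        constructor <;> linarith [k0.1, k0.2, hca1.1, hca1.2, hc2a2.1, hc2a2.2]
      have hdist : dist (y q) (y q') ≤ ℓ * (13 * δ) := by
        rw [EuclideanSpace.dist_eq]
        refine Real.sqrt_le_iff.2 ⟨by positivity, ?_⟩
        have e : ∀ k, dist (y q k) (y q' k) ^ 2 = ℓ ^ 2 * |a k| ^ 2 := by
          intro k
          rw [Real.dist_eq, ha, abs_div, abs_of_pos hℓ]
          field_simp
        simp only [e, Fin.sum_univ_three, mul_pow, ← mul_add]
        gcongr
        have n0 := pow_le_pow_left₀ (abs_nonneg _) m0 2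
        have n1 := pow_le_pow_left₀ (abs_nonneg _) m1 2
        have n2 := pow_le_pow_left₀ (abs_nonneg _) k2 2
        nlinarith
      have : ℓ * (13 * δ) < ℓ / (2 * K) := by
        rw [hδ, lt_div_iff₀ (by positivity)]
        field_simp
        norm_num
      linarith) hA x
  refine h.trans_eq ?_
  push_cast
  ring

lemma rpow_two_thirds_mul {R : ℝ} (hR : 0 < R) :
    R = R ^ ((2 : ℝ) / 3) * R ^ ((1 : ℝ) / 3) := by
  rw [← Real.rpow_add hR]; norm_num

lemma rpow_five_sixths {R : ℝ} (hR : 0 < R) :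
    R ^ ((5 : ℝ) / 6) = R ^ ((2 : ℝ) / 3) * Real.sqrt (R ^ ((1 : ℝ) / 3)) := by
  rw [Real.sqrt_eq_rpow, ← Real.rpow_mul hR.le, ← Real.rpow_add hR]; norm_num

lemma leftEndpoint_eq {R : ℝ} (hR : 0 < R) (j : Fin (numIntervals R)) :
    leftEndpoint R j = (j : ℕ) / R ^ ((1 : ℝ) / 3) := by
  rw [leftEndpoint, Real.rpow_neg hR.le, ← div_eq_mul_inv]

lemma div_le_one_of_lt_numIntervals {R : ℝ} (hR : 0 < R) {j : ℕ} (hj : j < numIntervals R) :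
    (j : ℝ) / R ^ ((1 : ℝ) / 3) ≤ 1 := by
  rw [div_le_one (Real.rpow_pos_of_pos hR _)]
  exact (Nat.lt_ceil.1 hj).le

lemma numIntervals_le {R : ℝ} (hR : 1 ≤ R) :
    (numIntervals R : ℝ) ≤ 2 * R ^ ((1 : ℝ) / 3) := by
  have h1 : 1 ≤ R ^ ((1 : ℝ) / 3) := Real.one_le_rpow hR (by norm_num)
  have h2 := Nat.ceil_lt_add_one (zero_le_one.trans h1)
  rw [numIntervals]
  linarith

lemma exists_centers_of_isSeparatedTubeFamily {K : ℕ} {R : ℝ}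
    {T : Fin (numIntervals R) → Finset (Set E3)} (hT : IsSeparatedTubeFamily K R T)
    (hR : 0 < R) :
    ∃ p : Fin (numIntervals R) → Set E3 → E3, ∀ j, ∀ t ∈ T j, p j t ∈ t ∧ ∀ x ∈ t, ∀ k,
      |coord ((j : ℕ) / R ^ ((1 : ℝ) / 3)) (rescale (R ^ ((2 : ℝ) / 3)) x) k -
        coord ((j : ℕ) / R ^ ((1 : ℝ) / 3)) (rescale (R ^ ((2 : ℝ) / 3)) (p j t)) k| ≤
        K * (![1, 1, R ^ ((1 : ℝ) / 3)] : Fin 3 → ℝ) k := by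
  have hℓ : 0 < R ^ ((2 : ℝ) / 3) := Real.rpow_pos_of_pos hR _
  have hL : 0 < R ^ ((1 : ℝ) / 3) := Real.rpow_pos_of_pos hR _
  have h : ∀ j, ∀ t ∈ T j, ∃ v : E3, v ∈ t ∧ ∀ x ∈ t, ∀ k,
      |coord ((j : ℕ) / R ^ ((1 : ℝ) / 3)) (rescale (R ^ ((2 : ℝ) / 3)) x) k -
        coord ((j : ℕ) / R ^ ((1 : ℝ) / 3)) (rescale (R ^ ((2 : ℝ) / 3)) v) k| ≤
        K * (![1, 1, R ^ ((1 : ℝ) / 3)] : Fin 3 → ℝ) k := by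
    intro j t ht
    have h1 := ((hT j).1 t ht).1
    rw [leftEndpoint_eq hR] at h1
    obtain ⟨v, hv1, hv2⟩ := exists_center_of_isFrenetBox (D := ![1, 1, R ^ ((1 : ℝ) / 3)]) h1 hℓ
      (by simp) (by simp) (by simpa using rpow_two_thirds_mul hR)
    refine ⟨v, hv1 v fun k => ?_, hv2⟩
    rw [sub_self, abs_zero]
    refine div_nonneg ?_ (Nat.cast_nonneg _)
    fin_cases k <;> simp
    positivity
  choose! p hp using h
  exact ⟨p, fun j t ht => hp j t ht⟩

/-- The centers of a tube and a cube that meet are close to each other. -/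
lemma abs_coord_sub_le_of_inter {K : ℕ} {L ℓ c : ℝ} (hL : 1 ≤ L) (hℓ : 0 < ℓ) (h0 : 0 ≤ c)
    (h1 : c ≤ 1) {t q : Set E3} {v y : E3}
    (hv : ∀ x ∈ t, ∀ k, |coord c (rescale ℓ x) k - coord c (rescale ℓ v) k| ≤
      K * (![1, 1, L] : Fin 3 → ℝ) k)
    (hy : ∀ x ∈ q, ∀ k, |x k - y k| ≤ K * ℓ) (htq : (t ∩ q).Nonempty) (k : Fin 3) :
    |coord c (rescale ℓ v) k - coord c (rescale ℓ y) k| ≤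
      7 * K * (![1, 1, L] : Fin 3 → ℝ) k := by
  obtain ⟨x, hxt, hxq⟩ := htq
  have hK : (0 : ℝ) ≤ K := Nat.cast_nonneg _
  set a := fun k => (x k - y k) / ℓ with ha
  have hab : ∀ k, |a k| ≤ K := fun k => by
    rw [ha, abs_div, abs_of_pos hℓ, div_le_iff₀ hℓ]; exact hy x hxq k
  have hc : ∀ k, |c * a k| ≤ K := fun k => by
    rw [abs_mul, abs_of_nonneg h0]
    exact (mul_le_of_le_one_left (abs_nonneg _) h1).trans (hab k)
  have hc2 : ∀ k, |c ^ 2 * a k| ≤ K := fun k => by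
    rw [abs_mul, abs_of_nonneg (sq_nonneg c)]
    exact (mul_le_of_le_one_left (abs_nonneg _) (pow_le_one₀ h0 h1)).trans (hab k)
  have hxy : |coord c (rescale ℓ x) k - coord c (rescale ℓ y) k| ≤ 6 * K := by
    have e : coord c (rescale ℓ x) k - coord c (rescale ℓ y) k = coord c a k := by
      fin_cases k <;> simp [coord, rescale, ha] <;> ring
    rw [e]
    have a0 := abs_le.1 (hab 0)
    have a1 := abs_le.1 (hab 1)
    have a2 := abs_le.1 (hab 2)
    have c1 := abs_le.1 (hc 1)
    have c2 := abs_le.1 (hc 2)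
    have d2 := abs_le.1 (hc2 2)
    rw [abs_le]
    fin_cases k <;> simp [coord] <;> constructor <;> linarith
  have hD : 1 ≤ (![1, 1, L] : Fin 3 → ℝ) k := by fin_cases k <;> simp [hL]
  have h2 := hv x hxt k
  have e : coord c (rescale ℓ v) k - coord c (rescale ℓ y) k =
    (coord c (rescale ℓ x) k - coord c (rescale ℓ y) k) -
    (coord c (rescale ℓ x) k - coord c (rescale ℓ v) k) := by ring
  rw [e]
  refine (abs_sub _ _).trans ?_
  nlinarith [mul_le_mul_of_nonneg_left hD hK]

open Classical in
lemma richness_eq {n : ℕ} (T : Fin n → Finset (Set E3)) (q : Set E3) :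
    (richness T q : ℝ) = ∑ j, ∑ t ∈ T j, if (t ∩ q).Nonempty then (1 : ℝ) else 0 := by
  rw [richness, Nat.cast_sum]
  refine Finset.sum_congr rfl fun j _ => ?_
  rw [Finset.sum_boole, ← Set.ncard_coe_finset]
  congr 2
  ext t
  simp

/-- The trivial bound: a tube meets at most about `R^(1/3)` of the cubes. -/
lemma card_mul_le {K : ℕ} (hK : 1 ≤ K) :
    ∃ C : ℝ, 0 < C ∧ ∀ (R : ℝ) (T : Fin (numIntervals R) → Finset (Set E3)) (r : ℝ)
      (Q : Finset (Set E3)), 1 ≤ R → IsSeparatedTubeFamily K R T → IsRichCubeFamily K R r T Q →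
      (Q.card : ℝ) * r ≤ C * ((∑ j, ((T j).card : ℝ)) * R ^ ((1 : ℝ) / 3)) := by
  have hK1 : (1 : ℝ) ≤ K := by exact_mod_cast hK
  refine ⟨(1 + (7 * (K : ℝ)) ^ 2) ^ 3 * (64 * (1600 * K) ^ 3), by positivity, ?_⟩
  intro R T r Q hR1 hT hQ
  classical
  have hR : 0 < R := by linarith
  obtain ⟨p, hp⟩ := exists_centers_of_isSeparatedTubeFamily hT hR
  obtain ⟨y, hy1, hy2⟩ := exists_centers_of_isRichCubeFamily hQ hK hR
  set L := R ^ ((1 : ℝ) / 3) with hL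
  set ℓ := R ^ ((2 : ℝ) / 3) with hℓdef
  have hℓ : 0 < ℓ := Real.rpow_pos_of_pos hR _
  have hL1 : 1 ≤ L := Real.one_le_rpow hR1 (by norm_num)
  have hA : ∀ k, 1 ≤ (![1, 1, L] : Fin 3 → ℝ) k := by intro k; fin_cases k <;> simp [hL1]
  have htube : ∀ j, ∀ t ∈ T j, ∑ q ∈ Q, (if (t ∩ q).Nonempty then (1 : ℝ) else 0) ≤
      (1 + (7 * (K : ℝ)) ^ 2) ^ 3 * (64 * (1600 * K) ^ 3) * L := by
    intro j t ht
    have h0 : (0 : ℝ) ≤ (j : ℕ) / L := by positivity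
    have h1 := div_le_one_of_lt_numIntervals hR j.2
    have hterm : ∀ q ∈ Q, (if (t ∩ q).Nonempty then (1 : ℝ) else 0) ≤
        (1 + (7 * (K : ℝ)) ^ 2) ^ 3 * ∏ k, 1 / (1 + ((coord ((j : ℕ) / L) (rescale ℓ (y q)) k -
          coord ((j : ℕ) / L) (rescale ℓ (p j t)) k) / (![1, 1, L] : Fin 3 → ℝ) k) ^ 2) := by
      intro q hq
      split_ifs with htq
      · have h2 := abs_coord_sub_le_of_inter hL1 hℓ h0 h1 (hp j t ht).2 (hy1 q hq) htq
        have h3 : ∀ k, 1 / (1 + (7 * (K : ℝ)) ^ 2) ≤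
            1 / (1 + ((coord ((j : ℕ) / L) (rescale ℓ (y q)) k -
            coord ((j : ℕ) / L) (rescale ℓ (p j t)) k) / (![1, 1, L] : Fin 3 → ℝ) k) ^ 2) := by
          intro k
          have hAk : 0 < (![1, 1, L] : Fin 3 → ℝ) k := by linarith [hA k]
          refine one_div_le_one_div_of_le (by positivity) ?_
          rw [add_le_add_iff_left, ← sq_abs, abs_div, abs_of_pos hAk, abs_sub_comm]
          refine pow_le_pow_left₀ (by positivity) ?_ 2
          rw [div_le_iff₀ hAk]
          exact h2 k
        calc (1 : ℝ) = (1 + (7 * (K : ℝ)) ^ 2) ^ 3 * ∏ _k : Fin 3, 1 / (1 + (7 * (K : ℝ)) ^ 2) := by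
              simp; field_simp
          _ ≤ _ := mul_le_mul_of_nonneg_left
              (Finset.prod_le_prod (fun k _ => by positivity) fun k _ => h3 k) (by positivity)
      · exact mul_nonneg (by positivity) (Finset.prod_nonneg fun k _ => by positivity)
    refine (Finset.sum_le_sum hterm).trans ?_
    rw [← Finset.mul_sum, mul_assoc]
    refine mul_le_mul_of_nonneg_left ?_ (by positivity)
    have := sum_prod_le_of_separated hK hℓ h0 h1 Q hy2 hA
      (coord ((j : ℕ) / L) (rescale ℓ (p j t)))
    simpa [Fin.prod_univ_three] using this
  calc (Q.card : ℝ) * r ≤ ∑ q ∈ Q, (richness T q : ℝ) := by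
        rw [← nsmul_eq_mul]
        exact Finset.card_nsmul_le_sum _ _ _ fun q hq => (hQ.1 q hq).2
    _ = ∑ j, ∑ t ∈ T j, ∑ q ∈ Q, (if (t ∩ q).Nonempty then (1 : ℝ) else 0) := by
        simp only [richness_eq]
        rw [Finset.sum_comm]
        exact Finset.sum_congr rfl fun j _ => Finset.sum_comm
    _ ≤ ∑ j, ∑ t ∈ T j, (1 + (7 * (K : ℝ)) ^ 2) ^ 3 * (64 * (1600 * K) ^ 3) * L :=
        Finset.sum_le_sum fun j _ => Finset.sum_le_sum (htube j)
    _ = _ := by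
        simp only [Finset.sum_const, nsmul_eq_mul, ← Finset.sum_mul]
        ring

/-- The high-low bound: if each plank of dimensions `(R^(2/3), R^(2/3) * Λ, R)` contains at most
`n` of the tubes of its direction, and the cubes are sufficiently rich, then there are few. -/
lemma card_mul_sq_le_of_atMostPerBox {K : ℕ} (hK : 1 ≤ K) :
    ∃ C : ℝ, 0 < C ∧ ∀ (R : ℝ) (T : Fin (numIntervals R) → Finset (Set E3)) (n : ℕ) (r Λ d : ℝ)
      (Q : Finset (Set E3)), 1 ≤ R → IsSeparatedTubeFamily K R T → IsRichCubeFamily K R r T Q →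
      1 ≤ Λ → Λ ≤ R ^ ((1 : ℝ) / 3) → d = R ^ ((2 : ℝ) / 3) * Λ →
      AtMostPerBox K R (R ^ ((2 : ℝ) / 3)) d R T n → 0 < r →
      C * (n * R ^ ((1 : ℝ) / 3)) ≤ Λ * r →
      (Q.card : ℝ) * r ^ 2 ≤ C * ((1 + Real.log ⌈Λ⌉₊) * (∑ j, ((T j).card : ℝ)) *
        R ^ ((1 : ℝ) / 3) * n) := by
  have hK1 : (1 : ℝ) ≤ K := by exact_mod_cast hK
  set C₁ : ℝ := 8 * (2 * (1 + (K : ℝ) ^ 2)) ^ 3 * (64 * (16 * K) ^ 3 * K) * 2 with hC₁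
  set C₂ : ℝ := 8 * (64 * (1600 * K) ^ 3) with hC₂
  set c₀ : ℝ := Real.exp (-(1 / 2) * (3 * (7 * K) ^ 2)) with hc₀
  have hC₁0 : 0 < C₁ := by positivity
  have hC₂0 : 0 < C₂ := by positivity
  have hc₀0 : 0 < c₀ := Real.exp_pos _
  set Ca := 64 * (473850 * C₂) / c₀ ^ 2 * C₁ with hCa
  set Cb := 4 * C₁ / c₀ with hCb
  have hCa0 : 0 < Ca := by positivity
  have hCb0 : 0 < Cb := by positivity
  refine ⟨Ca + Cb, by positivity, ?_⟩
  intro R T n r Λ d Q hR1 hT hQ hΛ hΛL hd hn hr hrn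
  classical
  have hR : 0 < R := by linarith
  obtain ⟨p, hp⟩ := exists_centers_of_isSeparatedTubeFamily hT hR
  obtain ⟨y, hy1, hy2⟩ := exists_centers_of_isRichCubeFamily hQ hK hR
  have hRL := rpow_two_thirds_mul hR
  have hm2 := numIntervals_le hR1
  have hm := fun j (hj : j < numIntervals R) => div_le_one_of_lt_numIntervals hR hj
  have hleft := leftEndpoint_eq hR
  set L := R ^ ((1 : ℝ) / 3) with hL
  set ℓ := R ^ ((2 : ℝ) / 3) with hℓdef
  have hℓ : 0 < ℓ := Real.rpow_pos_of_pos hR _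
  have hL1 : 1 ≤ L := hΛ.trans hΛL
  have hL0 : 0 < L := by linarith
  have hΛ0 : 0 < Λ := by linarith
  have hn0 : (0 : ℝ) ≤ n := Nat.cast_nonneg _
  have hlog : 0 ≤ 1 + Real.log ⌈Λ⌉₊ := by
    have := Real.log_nonneg (show (1 : ℝ) ≤ ⌈Λ⌉₊ by exact_mod_cast Nat.one_le_ceil_iff.2 hΛ0)
    linarith
  have hmain := card_mul_sq_le (n := n) (r := r) (C₁ := C₁) (C₂ := C₂) (c₀ := c₀) hΛ hΛL hm hm2 T
    (fun j t => rescale ℓ (p j t)) Q (fun q => rescale ℓ (y q)) hC₂0 hc₀0 hr (by positivity)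
    (by
      intro j x
      obtain ⟨F, hF1, -, hF2, hF3, hF4⟩ := hn j
      rw [hleft] at hF1
      have h1 := sum_gauss_le_of_boxes (K := K) (n := n) hK hℓ (D := ![1, Λ, L])
        (e := ![1, 2 * Λ, L]) (c := (j : ℕ) / L)
        (by intro k; fin_cases k <;> simp [hΛ0, hL0])
        (by intro k; fin_cases k <;> simp; linarith) (by simp) (by simpa using hd)
        (by simpa using hRL) (T j) (p := p j) (fun t ht => (hp j t ht).1) hF1 hF2 hF3 hF4 x
      refine h1.trans_eq ?_
      have : ∏ k, (![1, 2 * Λ, L] : Fin 3 → ℝ) k / (![1, Λ, L] : Fin 3 → ℝ) k = 2 := by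
        simp [Fin.prod_univ_three]; field_simp
      rw [this])
    (by
      intro q hq
      have h1 := sum_prod_le_of_separated hK hℓ le_rfl zero_le_one Q hy2 (A := fun _ => 1)
        (fun _ => le_rfl) (coord 0 (rescale ℓ (y q)))
      simp only [Finset.prod_const_one, mul_one] at h1
      rw [hC₂]
      refine le_trans ?_ (mul_le_mul_of_nonneg_left h1 (by norm_num : (0 : ℝ) ≤ 8))
      rw [Finset.mul_sum]
      refine Finset.sum_le_sum fun q' _ => (gauss_le_prod _ _).trans ?_
      refine mul_le_mul_of_nonneg_left ?_ (by norm_num)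
      refine Finset.prod_le_prod (fun k _ => by positivity) fun k _ => ?_
      refine one_div_le_one_div_of_le (by positivity) ?_
      rw [coord_sub, Pi.sub_apply]
      nlinarith [sq_nonneg (coord 0 (rescale ℓ (y q)) k - coord 0 (rescale ℓ (y q')) k)])
    (by
      intro q hq
      have h1 := (hQ.1 q hq).2
      rw [richness_eq] at h1
      refine (mul_le_mul_of_nonneg_left h1 hc₀0.le).trans ?_
      simp only [Finset.mul_sum]
      refine Finset.sum_le_sum fun j _ => Finset.sum_le_sum fun t ht => ?_
      split_ifs with htq
      · rw [mul_one, hc₀, gauss]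
        refine Real.exp_le_exp.2 ?_
        have h2 := abs_coord_sub_le_of_inter hL1 hℓ (by positivity) (hm j j.2) (hp j t ht).2
          (hy1 q hq) htq
        have h3 : ∀ k, (coord ((j : ℕ) / L) (rescale ℓ (p j t) - rescale ℓ (y q)) k /
            (![1, 1, L] : Fin 3 → ℝ) k) ^ 2 ≤ (7 * (K : ℝ)) ^ 2 := by
          intro k
          have hAk : 0 < (![1, 1, L] : Fin 3 → ℝ) k := by fin_cases k <;> simp [hL0]
          rw [← sq_abs, abs_div, abs_of_pos hAk]
          refine pow_le_pow_left₀ (by positivity) ?_ 2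
          rw [div_le_iff₀ hAk, coord_sub]
          exact h2 k
        rw [Fin.sum_univ_three]
        linarith [h3 0, h3 1, h3 2]
      · rw [mul_zero]; exact gauss_nonneg _ _)
    (by
      have h1 : Cb * (n * L) ≤ Λ * r := by
        refine le_trans ?_ hrn
        gcongr
        linarith
      calc 4 * (C₁ * n) * L = c₀ * (Cb * (n * L)) := by rw [hCb]; field_simp
        _ ≤ c₀ * (Λ * r) := by gcongr
        _ = _ := by ring)
  calc (Q.card : ℝ) * r ^ 2 ≤ _ := hmain
    _ = Ca * ((1 + Real.log ⌈Λ⌉₊) * (∑ j, ((T j).card : ℝ)) * L * n) := by rw [hCa]; ring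
    _ ≤ _ := mul_le_mul_of_nonneg_right (by linarith) (mul_nonneg (mul_nonneg (mul_nonneg hlog
        (Finset.sum_nonneg fun _ _ => Nat.cast_nonneg _)) hL0.le) hn0)

lemma exists_half_pow_mem_Ico {x : ℝ} (h0 : 0 < x) (h1 : x ≤ 1) :
    ∃ k : ℕ, x / 2 ≤ (1 / 2 : ℝ) ^ k ∧ (1 / 2 : ℝ) ^ k < x := by
  obtain ⟨k, hk1, hk2⟩ := exists_nat_pow_near_of_lt_one h0 h1 (by norm_num : (0 : ℝ) < 1 / 2)
    (by norm_num)
  refine ⟨k + 1, ?_, hk1⟩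
  rw [pow_succ]
  linarith

lemma half_le_floor {x : ℝ} (hx : 1 ≤ x) : x / 2 ≤ (⌊x⌋₊ : ℝ) := by
  have h1 := Nat.lt_floor_add_one x
  have h2 : (1 : ℝ) ≤ ⌊x⌋₊ := by exact_mod_cast (Nat.one_le_floor_iff x).2 hx
  linarith

/-- The choice of the scale `σ` below the critical scale. Here `g` is the sixth root of `R`. -/
lemma exists_scale_of_rich_le {c g l r X W N N₁ : ℝ} (hc : 1 ≤ c) (hg : 2 ≤ g) (hl : 1 / 2 ≤ l)
    (hr : 1 ≤ r) (hW : 0 ≤ W) (hN₁ : 1 ≤ N₁) (hN : N₁ ≤ N)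
    (hX : X * r ^ 2 ≤ 10 * c ^ 2 * l * (W * g ^ 2 * min N (N₁ * g)))
    (hrN : r ≤ 4 * c * (N₁ * g)) :
    ∃ (k M : ℕ), (g ^ 2)⁻¹ ≤ (1 / 2 : ℝ) ^ k ∧ (1 / 2 : ℝ) ^ k < g⁻¹ ∧
      X ≤ 100 * c ^ 2 * l * (W * M * ((1 / 2 : ℝ) ^ k) ^ 3 * (g ^ 2) ^ 2 / r ^ 2) ∧
      r ≤ 100 * c ^ 2 * l * ((g ^ 2) ^ 2 * M * ((1 / 2 : ℝ) ^ k) ^ 4) ∧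
      (M : ℝ) ≤ 100 * c ^ 2 * ((((1 / 2 : ℝ) ^ k) ^ 3)⁻¹ * (g ^ 2)⁻¹ *
        min (N₁ * ((1 / 2 : ℝ) ^ k)⁻¹ * g⁻¹) N) := by
  have hg0 : 0 < g := by linarith
  set m := min N (N₁ * g) with hm
  have hm1 : N₁ ≤ m := le_min hN (by nlinarith)
  have hm0 : 0 < m := by linarith
  have hmg : m ≤ N₁ * g := min_le_right _ _
  have hmN : m ≤ N := min_le_left _ _
  set τ := N₁ / (m * g) with hτ
  have hτ0 : 0 < τ := by positivity
  have hτ1 : (g ^ 2)⁻¹ ≤ τ := by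
    rw [hτ, inv_eq_one_div, div_le_div_iff₀ (by positivity) (by positivity)]
    nlinarith
  have hτ2 : τ ≤ g⁻¹ := by
    rw [hτ, inv_eq_one_div, div_le_div_iff₀ (by positivity) (by positivity)]
    nlinarith
  have hginv : g⁻¹ ≤ 1 := inv_le_one_of_one_le₀ (by linarith)
  obtain ⟨k, hk1, hk2⟩ := exists_half_pow_mem_Ico (x := min (2 * τ) g⁻¹)
    (lt_min (by positivity) (by positivity)) ((min_le_right _ _).trans hginv)
  set σ := (1 / 2 : ℝ) ^ k with hσ
  have hσ0 : 0 < σ := by positivity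
  have hστ : σ ≤ 2 * τ := (hk2.trans_le (min_le_left _ _)).le
  have hσg : σ < g⁻¹ := hk2.trans_le (min_le_right _ _)
  have hσg' : σ * g ≤ 1 := by
    have := mul_le_mul_of_nonneg_right hσg.le hg0.le
    rwa [inv_mul_cancel₀ hg0.ne'] at this
  have hlow : τ / 2 ≤ σ ∧ (g ^ 2)⁻¹ ≤ σ := by
    have h1 : (g ^ 2)⁻¹ ≤ g⁻¹ / 2 := by
      rw [← one_div, ← one_div, div_div, div_le_div_iff₀ (by positivity) (by positivity)]
      nlinarith
    rcases min_choice (2 * τ) g⁻¹ with h | h <;> rw [h] at hk1 <;> constructor <;> linarith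
  set n := min (N₁ * σ⁻¹ * g⁻¹) N with hn
  have hn1 : 1 ≤ n := by
    refine le_min ?_ (by linarith)
    rw [mul_assoc, ← mul_inv]
    have : 1 ≤ (σ * g)⁻¹ := (one_le_inv₀ (by positivity)).2 hσg'
    nlinarith
  have hnm : m / 2 ≤ n := by
    refine le_min ?_ (by linarith)
    rw [mul_assoc, ← mul_inv, ← div_eq_mul_inv, le_div_iff₀ (by positivity)]
    have : σ * (m * g) ≤ 2 * N₁ := by
      calc σ * (m * g) ≤ 2 * τ * (m * g) := by gcongr
        _ = _ := by rw [hτ]; field_simp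
    linarith
  have hnr : N₁ * g / 2 ≤ g ^ 2 * σ * n := by
    rcases min_choice (N₁ * σ⁻¹ * g⁻¹) N with h | h
    · rw [hn, h]
      have : g ^ 2 * σ * (N₁ * σ⁻¹ * g⁻¹) = N₁ * g := by field_simp
      rw [this]
      linarith [mul_pos (by linarith : 0 < N₁) hg0]
    · rw [hn, h]
      calc N₁ * g / 2 = g ^ 2 * (τ / 2) * m := by rw [hτ]; field_simp
        _ ≤ g ^ 2 * σ * N := by
          gcongr
          exact hlow.1
  set x := (σ ^ 3)⁻¹ * (g ^ 2)⁻¹ * n with hx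
  have hxn : x * (σ ^ 3 * g ^ 2) = n := by rw [hx]; field_simp
  have hx1 : 1 ≤ x := by
    have h1 : σ ^ 3 * g ^ 2 ≤ 1 := by
      have h2 : σ ≤ 1 := hσg.le.trans hginv
      calc σ ^ 3 * g ^ 2 = σ * (σ * g) ^ 2 := by ring
        _ ≤ 1 * 1 ^ 2 := by gcongr
        _ = 1 := by norm_num
    have h3 : 0 < σ ^ 3 * g ^ 2 := by positivity
    by_contra! h4
    nlinarith
  have hM := half_le_floor hx1
  have hMn : n / 2 ≤ ⌊x⌋₊ * (σ ^ 3 * g ^ 2) := by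
    rw [← hxn, mul_div_right_comm]
    exact mul_le_mul_of_nonneg_right hM (by positivity)
  have hl0 : 0 < l := by linarith
  have hc2 : 1 ≤ c ^ 2 := one_le_pow₀ hc
  refine ⟨k, ⌊x⌋₊, hlow.2, hσg, ?_, ?_, ?_⟩
  · rw [mul_div_assoc', le_div_iff₀ (by positivity)]
    calc X * r ^ 2 ≤ 10 * c ^ 2 * l * (W * g ^ 2 * m) := hX
      _ ≤ 10 * c ^ 2 * l * (W * g ^ 2 * (4 * (⌊x⌋₊ * (σ ^ 3 * g ^ 2)))) := by
        gcongr
        linarith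
      _ = 40 * (c ^ 2 * l * (W * ⌊x⌋₊ * σ ^ 3 * (g ^ 2) ^ 2)) := by ring
      _ ≤ 100 * (c ^ 2 * l * (W * ⌊x⌋₊ * σ ^ 3 * (g ^ 2) ^ 2)) := by
        gcongr
        norm_num
      _ = _ := by ring
  · calc r ≤ 4 * c * (N₁ * g) := hrN
      _ ≤ 4 * c * (4 * (g ^ 2 * σ * (⌊x⌋₊ * (σ ^ 3 * g ^ 2)))) := by
        refine mul_le_mul_of_nonneg_left ?_ (by positivity)
        have : g ^ 2 * σ * (n / 2) ≤ g ^ 2 * σ * (⌊x⌋₊ * (σ ^ 3 * g ^ 2)) := by gcongr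
        linarith
      _ = 16 * c * ((g ^ 2) ^ 2 * ⌊x⌋₊ * σ ^ 4) := by ring
      _ ≤ 100 * c ^ 2 * l * ((g ^ 2) ^ 2 * ⌊x⌋₊ * σ ^ 4) := by
        refine mul_le_mul_of_nonneg_right ?_ (by positivity)
        nlinarith
  · have h1 : (⌊x⌋₊ : ℝ) ≤ x := Nat.floor_le (by linarith)
    calc (⌊x⌋₊ : ℝ) ≤ 1 * x := by linarith
      _ ≤ 100 * c ^ 2 * x := by gcongr; linarith

/-- The choice of the scale `σ` above the critical scale. Here `g` is the sixth root of `R`. -/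
lemma exists_scale_of_lt_rich {c g l r X W N₁ : ℝ} (hc : 1 ≤ c) (hg : 1 ≤ g) (hl : 1 / 2 ≤ l)
    (hr : 1 ≤ r) (hrL : r ≤ g ^ 2) (hW : 0 ≤ W) (hN₁ : 1 ≤ N₁)
    (hX : X * r ^ 2 ≤ 5 * c * l * (W * g ^ 2 * N₁)) (hrN : 4 * c * (N₁ * g) < r) :
    ∃ (k M : ℕ), g⁻¹ ≤ (1 / 2 : ℝ) ^ k ∧
      X ≤ 100 * c ^ 2 * l * (W * M * (1 / 2 : ℝ) ^ k * g ^ 2 / r ^ 2) ∧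
      r ≤ 100 * c ^ 2 * l * (g ^ 2 * M * ((1 / 2 : ℝ) ^ k) ^ 2) ∧
      (M : ℝ) ≤ 100 * c ^ 2 * (((1 / 2 : ℝ) ^ k)⁻¹ * min N₁ ((1 / 2 : ℝ) ^ k)⁻¹) := by
  have hg0 : 0 < g := by linarith
  have hN0 : 0 < N₁ := by linarith
  have hl0 : 0 < l := by linarith
  have hc2 : c ≤ c ^ 2 := by nlinarith
  have hNg : 2 * N₁ ≤ g := by
    by_contra! h
    nlinarith [mul_pos hN0 hg0]
  obtain ⟨k, hk1, hk2⟩ := exists_half_pow_mem_Ico (x := N₁⁻¹) (by positivity)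
    (inv_le_one_of_one_le₀ hN₁)
  set σ := (1 / 2 : ℝ) ^ k with hσ
  have hσ0 : 0 < σ := by positivity
  have hσN : N₁ ≤ σ⁻¹ := (le_inv_comm₀ hσ0 hN0).1 hk2.le
  have hσN2 : 1 / 2 ≤ N₁ * σ := by
    have := mul_le_mul_of_nonneg_left hk1 hN0.le
    rwa [mul_div_assoc', mul_inv_cancel₀ hN0.ne'] at this
  have hgσ : g⁻¹ ≤ σ := by
    refine le_trans ?_ hk1
    rw [← one_div, ← one_div, div_div, div_le_div_iff₀ hg0 (by positivity)]
    linarith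
  have hx1 : 1 ≤ σ⁻¹ * N₁ := one_le_mul_of_one_le_of_one_le (hN₁.trans hσN) hN₁
  have hM := half_le_floor hx1
  set M := ⌊σ⁻¹ * N₁⌋₊
  have hMσ : N₁ / 2 ≤ M * σ := by
    have := mul_le_mul_of_nonneg_right hM hσ0.le
    have e : σ⁻¹ * N₁ / 2 * σ = N₁ / 2 := by field_simp
    rwa [e] at this
  refine ⟨k, M, hgσ, ?_, ?_, ?_⟩
  · rw [mul_div_assoc', le_div_iff₀ (by positivity)]
    calc X * r ^ 2 ≤ 5 * c * l * (W * g ^ 2 * N₁) := hX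
      _ ≤ 5 * c ^ 2 * l * (W * g ^ 2 * (2 * (M * σ))) := by
        gcongr
        linarith
      _ = 10 * (c ^ 2 * l * (W * M * σ * g ^ 2)) := by ring
      _ ≤ 100 * (c ^ 2 * l * (W * M * σ * g ^ 2)) := by
        gcongr
        norm_num
      _ = _ := by ring
  · have h1 : 1 / 4 ≤ M * σ ^ 2 := by
      have : N₁ / 2 * σ ≤ M * σ * σ := by gcongr
      linarith [this, show (M : ℝ) * σ ^ 2 = M * σ * σ by ring]
    calc r ≤ g ^ 2 * 1 := by linarith
      _ ≤ g ^ 2 * (100 * c ^ 2 * l * (M * σ ^ 2)) := by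
        gcongr
        have h2 : 1 / 2 ≤ c ^ 2 * l := by nlinarith
        nlinarith
      _ = _ := by ring
  · rw [min_eq_left hσN]
    have h1 : (M : ℝ) ≤ σ⁻¹ * N₁ := Nat.floor_le (by positivity)
    nlinarith

/-- The choice of the scale `σ`, given the trivial bound and the high-low bounds. -/
lemma exists_scale {c g l r X W N N₁ : ℝ} (hc : 1 ≤ c) (hg1 : 1 ≤ g) (hl : 1 / 2 ≤ l)
    (hr : 1 ≤ r) (hrL : r ≤ g ^ 2) (hW : 0 ≤ W) (hN₁ : 1 ≤ N₁) (hN₁N : N₁ ≤ N)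
    (ht : X * r ≤ c * (W * g ^ 2))
    (hplate : c * (N * g ^ 2) ≤ g ^ 2 * r → X * r ^ 2 ≤ 5 * c * l * (W * g ^ 2 * N))
    (hbox : c * (N₁ * g ^ 2) ≤ g * r → X * r ^ 2 ≤ 5 * c * l * (W * g ^ 2 * N₁)) :
    ∃ (σ : ℝ) (M : ℕ),
      (∃ k : ℕ, σ = (1 / 2 : ℝ) ^ k) ∧ (g ^ 2)⁻¹ ≤ σ ∧ σ ≤ 1 ∧
      (g⁻¹ ≤ σ →
        X ≤ 100 * c ^ 2 * l * (W * M * σ * g ^ 2 / r ^ 2) ∧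
        r ≤ 100 * c ^ 2 * l * (g ^ 2 * M * σ ^ 2) ∧
        (M : ℝ) ≤ 100 * c ^ 2 * (σ⁻¹ * min N₁ σ⁻¹)) ∧
      (σ < g⁻¹ →
        X ≤ 100 * c ^ 2 * l * (W * M * σ ^ 3 * (g ^ 2) ^ 2 / r ^ 2) ∧
        r ≤ 100 * c ^ 2 * l * ((g ^ 2) ^ 2 * M * σ ^ 4) ∧
        (M : ℝ) ≤ 100 * c ^ 2 * ((σ ^ 3)⁻¹ * (g ^ 2)⁻¹ *
          min (N₁ * σ⁻¹ * g⁻¹) N)) := by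
  have hg0 : 0 < g := by linarith
  have hl0 : 0 < l := by linarith
  have hN0 : 0 ≤ N := by linarith
  have hginv : g⁻¹ ≤ 1 := inv_le_one_of_one_le₀ hg1
  have hg2inv : (g ^ 2)⁻¹ ≤ g⁻¹ := inv_anti₀ hg0 (by nlinarith)
  have hhalf : ∀ k : ℕ, (1 / 2 : ℝ) ^ k ≤ 1 := fun k => pow_le_one₀ (by norm_num) (by norm_num)
  have hc2 : 1 ≤ c ^ 2 := one_le_pow₀ hc
  rcases lt_or_ge g 2 with hg2 | hg2
  · refine ⟨1, 1, ⟨0, by simp⟩, hg2inv.trans hginv, le_rfl, fun _ => ⟨?_, ?_, ?_⟩,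
      fun h => absurd h (not_lt.2 hginv)⟩
    · rw [mul_div_assoc', le_div_iff₀ (by positivity)]
      calc X * r ^ 2 = X * r * r := by ring
        _ ≤ c * (W * g ^ 2) * g ^ 2 := by gcongr
        _ ≤ c ^ 2 * (W * g ^ 2) * 4 := by
          gcongr
          · nlinarith
          · nlinarith
        _ = 4 * (c ^ 2 * (W * g ^ 2)) := by ring
        _ ≤ (100 * l) * (c ^ 2 * (W * g ^ 2)) := by gcongr; linarith
        _ = _ := by ring
    · have : 1 ≤ 100 * c ^ 2 * l := by nlinarith
      rw [Nat.cast_one]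
      nlinarith [sq_nonneg g]
    · rw [inv_one, min_eq_right hN₁, Nat.cast_one]
      linarith
  rcases le_or_gt r (4 * c * (N₁ * g)) with hcase | hcase
  · have hX : X * r ^ 2 ≤ 10 * c ^ 2 * l * (W * g ^ 2 * min N (N₁ * g)) := by
      rcases min_choice N (N₁ * g) with h | h <;> rw [h]
      · rcases le_total (c * N) r with h1 | h1
        · have := hplate (by nlinarith [sq_nonneg g])
          refine this.trans ?_
          gcongr
          · norm_num
          · nlinarith
        · calc X * r ^ 2 = X * r * r := by ring
            _ ≤ c * (W * g ^ 2) * (c * N) := by gcongr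
            _ = 1 * (c ^ 2 * (W * g ^ 2 * N)) := by ring
            _ ≤ (10 * l) * (c ^ 2 * (W * g ^ 2 * N)) := by gcongr; linarith
            _ = _ := by ring
      · calc X * r ^ 2 = X * r * r := by ring
          _ ≤ c * (W * g ^ 2) * (4 * c * (N₁ * g)) := by gcongr
          _ = 4 * (c ^ 2 * (W * g ^ 2 * (N₁ * g))) := by ring
          _ ≤ (10 * l) * (c ^ 2 * (W * g ^ 2 * (N₁ * g))) := by gcongr; linarith
          _ = _ := by ring
    obtain ⟨k, M, h1, h2, h3, h4, h5⟩ := exists_scale_of_rich_le hc hg2 hl hr hW hN₁ hN₁N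
      hX hcase
    exact ⟨(1 / 2 : ℝ) ^ k, M, ⟨k, rfl⟩, h1, hhalf k, fun h => absurd h (not_le.2 h2),
      fun _ => ⟨h3, h4, h5⟩⟩
  · have hX := hbox (by
        have h1 : c * (N₁ * g) ≤ r := by
          have : 0 ≤ c * (N₁ * g) := by positivity
          linarith
        calc c * (N₁ * g ^ 2) = g * (c * (N₁ * g)) := by ring
          _ ≤ g * r := by gcongr)
    obtain ⟨k, M, h1, h2, h3, h4⟩ := exists_scale_of_lt_rich hc hg1 hl hr hrL hW hN₁ hX hcase
    exact ⟨(1 / 2 : ℝ) ^ k, M, ⟨k, rfl⟩, hg2inv.trans h1, hhalf k, fun _ => ⟨h2, h3, h4⟩,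
      fun h => absurd h (not_lt.2 h1)⟩

end FrenetBox

open FrenetBox in
theorem mainTheorem5 :
    ∃ A : ℕ, ∀ K : ℕ, 1 ≤ K → ∃ C : ℝ, 0 < C ∧
      ∀ (R : ℝ) (T : Fin (numIntervals R) → Finset (Set E3)) (N N₁ : ℕ) (r : ℝ)
        (Q : Finset (Set E3)),
        2 ≤ R →
        IsSeparatedTubeFamily K R T →
        AtMostPerBox K R (R ^ ((2 : ℝ) / 3)) R R T N →
        AtMostPerBox K R (R ^ ((2 : ℝ) / 3)) (R ^ ((5 : ℝ) / 6)) R T N₁ →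
        1 ≤ N₁ → N₁ ≤ N →
        1 ≤ r → r ≤ R ^ ((1 : ℝ) / 3) →
        IsRichCubeFamily K R r T Q →
        ∃ (σ : ℝ) (M : ℕ),
          (∃ k : ℕ, σ = (1 / 2 : ℝ) ^ k) ∧ R ^ (-((1 : ℝ) / 3)) ≤ σ ∧ σ ≤ 1 ∧
          (R ^ (-((1 : ℝ) / 6)) ≤ σ →
            (Q.card : ℝ) ≤ C * Real.log R ^ A *
              ((∑ j, ((T j).card : ℝ)) * M * σ * R ^ ((1 : ℝ) / 3) / r ^ 2) ∧
            r ≤ C * Real.log R ^ A * (R ^ ((1 : ℝ) / 3) * M * σ ^ 2) ∧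
            (M : ℝ) ≤ C * (σ⁻¹ * min (N₁ : ℝ) σ⁻¹)) ∧
          (σ < R ^ (-((1 : ℝ) / 6)) →
            (Q.card : ℝ) ≤ C * Real.log R ^ A *
              ((∑ j, ((T j).card : ℝ)) * M * σ ^ 3 * R ^ ((2 : ℝ) / 3) / r ^ 2) ∧
            r ≤ C * Real.log R ^ A * (R ^ ((2 : ℝ) / 3) * M * σ ^ 4) ∧
            (M : ℝ) ≤ C * ((σ ^ 3)⁻¹ * R ^ (-((1 : ℝ) / 3)) *
              min (N₁ * σ⁻¹ * R ^ (-((1 : ℝ) / 6))) (N : ℝ))) := by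
  refine ⟨1, fun K hK => ?_⟩
  obtain ⟨C₁, hC₁, htriv⟩ := card_mul_le hK
  obtain ⟨C₂, hC₂, hhigh⟩ := card_mul_sq_le_of_atMostPerBox hK
  set c := 1 + C₁ + C₂ with hcdef
  have hc : 1 ≤ c := by linarith
  refine ⟨100 * c ^ 2, by positivity, ?_⟩
  intro R T N N₁ r Q hR2 hT hN hN₁ hN₁1 hN₁N hr hrL hQ
  have hR : 0 < R := by linarith
  have hR1 : 1 ≤ R := by linarith
  set g := R ^ ((1 : ℝ) / 6) with hg
  have e13 : R ^ ((1 : ℝ) / 3) = g ^ 2 := by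
    rw [hg, ← Real.rpow_natCast, ← Real.rpow_mul hR.le]; norm_num
  have e23 : R ^ ((2 : ℝ) / 3) = (g ^ 2) ^ 2 := by
    rw [← e13, ← Real.rpow_natCast, ← Real.rpow_mul hR.le]; norm_num
  have e16' : R ^ (-((1 : ℝ) / 6)) = g⁻¹ := Real.rpow_neg hR.le _
  have e13' : R ^ (-((1 : ℝ) / 3)) = (g ^ 2)⁻¹ := by rw [Real.rpow_neg hR.le, e13]
  have hg1 : 1 ≤ g := Real.one_le_rpow hR1 (by norm_num)
  have hg0 : 0 < g := by linarith
  have hsqrt : Real.sqrt (R ^ ((1 : ℝ) / 3)) = g := by rw [e13, Real.sqrt_sq hg0.le]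
  have hl : 1 / 2 ≤ Real.log R := by
    have := Real.log_le_log two_pos hR2
    linarith [Real.log_two_gt_d9]
  have hlog : ∀ Λ : ℝ, 1 ≤ Λ → Λ ≤ g ^ 2 → 1 + Real.log ⌈Λ⌉₊ ≤ 5 * Real.log R := by
    intro Λ h1 h2
    have h3 : (⌈Λ⌉₊ : ℝ) ≤ 2 * g ^ 2 := by
      have := Nat.ceil_lt_add_one (zero_le_one.trans h1)
      linarith
    have h4 : Real.log ⌈Λ⌉₊ ≤ Real.log (2 * g ^ 2) :=
      Real.log_le_log (by exact_mod_cast Nat.ceil_pos.2 (by linarith)) h3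
    rw [Real.log_mul two_ne_zero (by positivity), ← e13, Real.log_rpow hR] at h4
    have := Real.log_le_log two_pos hR2
    linarith
  have hW : 0 ≤ ∑ j, ((T j).card : ℝ) := Finset.sum_nonneg fun _ _ => Nat.cast_nonneg _
  obtain ⟨W, hWdef⟩ : ∃ W, W = ∑ j, ((T j).card : ℝ) := ⟨_, rfl⟩
  obtain ⟨l, hldef⟩ : ∃ l, l = Real.log R := ⟨_, rfl⟩
  rw [← hWdef] at hW
  rw [← hldef] at hl hlog
  have hN₁1' : (1 : ℝ) ≤ N₁ := by exact_mod_cast hN₁1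
  have hN₁N' : (N₁ : ℝ) ≤ N := by exact_mod_cast hN₁N
  have ht : (Q.card : ℝ) * r ≤ c * (W * g ^ 2) := by
    have h1 := htriv R T r Q hR1 hT hQ
    rw [e13, ← hWdef] at h1
    refine h1.trans ?_
    gcongr
    linarith
  have hh : ∀ (n : ℕ) (Λ d : ℝ), 1 ≤ Λ → Λ ≤ g ^ 2 → d = R ^ ((2 : ℝ) / 3) * Λ →
      AtMostPerBox K R (R ^ ((2 : ℝ) / 3)) d R T n → c * (n * g ^ 2) ≤ Λ * r →
      (Q.card : ℝ) * r ^ 2 ≤ 5 * c * l * (W * g ^ 2 * n) := by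
    intro n Λ d h1 h2 h3 h4 h5
    have h6 := hhigh R T n r Λ d Q hR1 hT hQ h1 (h2.trans_eq e13.symm) h3 h4 (by linarith) (by
      rw [e13]
      refine le_trans ?_ h5
      gcongr
      linarith)
    rw [e13, ← hWdef] at h6
    calc _ ≤ _ := h6
      _ ≤ c * (5 * l * W * g ^ 2 * n) := by
        have h7 := hlog Λ h1 h2
        have h8 : 0 ≤ 1 + Real.log ⌈Λ⌉₊ := by
          have := Real.log_nonneg (show (1 : ℝ) ≤ ⌈Λ⌉₊ by
            exact_mod_cast Nat.one_le_ceil_iff.2 (by linarith))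
          linarith
        gcongr
        linarith
      _ = _ := by ring
  rw [e13] at hrL
  simp only [e13, e23, e16', e13', pow_one, ← hWdef, ← hldef]
  refine exists_scale hc hg1 hl hr hrL hW hN₁1' hN₁N' ht (hh N (g ^ 2) R (by nlinarith) le_rfl
    (by rw [← e13]; exact rpow_two_thirds_mul hR) hN) (hh N₁ g (R ^ ((5 : ℝ) / 6)) hg1
    (by nlinarith) (by rw [rpow_five_sixths hR, hsqrt]) hN₁)
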